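/- **Theorem (Online Shifted-and-Inverted Power Method, Warm Start).** Let $\mathcal D$ be a probability distribution on $\mathbb R^d$, $d\ge 2$, with $\mathbb E_{a\sim\mathcal D}\|a\|_2^4<\infty$. Let $\Sigma=\mathbb E_{a\sim\mathcal D}[aa^\top]$ have eigenvalues $\lambda_1\ge\lambda_2\ge\dots\ge\lambda_d$, let $v_1$ be a unit eigenvector for $\lambda_1$, and put $$\mathrm{gap}=\frac{\lambda_1-\lambda_2}{\lambda_1},\qquad v(\mathcal D)=\frac{\|\mathbb E_{a\sim\mathcal D}[(aa^\top)^2]\|_2}{\|\mathbb E_{a\sim\mathcal D}[aa^\top]\|_2^2},$$ where $\mathrm{gap}>0$. Let $\lambda$ satisfy $(1+\frac{\mathrm{gap}}{150})\lambda_1\le\lambda\le(1+\frac{\mathrm{gap}}{100})\lambda_1$, let $\hat\lambda_1$ satisfy $\frac{10}{11}(\lambda-\lambda_1)\le\lambda-\hat\lambda_1\le\lambda-\lambda_1$, and put $B=\lambda I-\Sigma$, $\|y\|_B=\sqrt{y^\top By}$. Let $x_0$ satisfy $v_1^\top x_0\ne 0$ and $$G(x_0)=\frac{\|x_0-(v_1^\top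 x_0)v_1\|_B}{\|(v_1^\top x_0)v_1\|_B}\le\frac1{\sqrt{10}} .$$ Consider the following streaming algorithm, which only has access to $\mathcal D$ through a stream of independent samples. Set $x=x_0/\|x_0\|_2$. In each round, compute $\hat x\approx B^{-1}x$ by a sequence of streaming SVRG steps started from $y=0$. One such step from $y_0$, with parameters $s>0$ and integers $k,m\ge1$, is as follows. With $\psi_a(y)=\frac12y^\top(\lambda I-aa^\top)y-x^\top y$, average $\nabla\psi_{a_i}(y_0)$ over $k$ fresh samples to get $g$. Draw $\tilde m$ uniformly from $\{1,\dots,m\}$. Starting from $y=y_0$, make $\tilde m$ updates $y\leftarrow y-s(\nabla\psi_{\tilde a}(y)-\nabla\psi_{\tilde a}(y_0)+g)$, each with a fresh sample $\tilde a$, and return the last $y$. Then estimate the Rayleigh quotient $\hat x^\top\Sigma\hat x/\|\hat x\|_2^2$ by the median of means of the values $(a^\top\hat x)^2/\|\hat x\|_2^2$ over batches of fresh samples $a$. Replace $x$ by $\hat x/\|\hat x\|_2$ if the estimate is at least $\hat\lambda_1-(\lambda-\hat\lambda_1)/6$ and $\|\hat x\|_2\ge\frac23\cdot\frac1{\lambda-\hat\lambda_1}$;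 otherwise keep $x$. Return the last $x$. There are a universal constant $C>0$ and a rule that chooses the number of rounds, the number of SVRG steps in each round, their parameters $(s,k,m)$, and the sizes and numbers of batches as functions of $(\lambda,\hat\lambda_1,v(\mathcal D),\varepsilon,\delta)$ only, such that for all $\mathcal D,\lambda,\hat\lambda_1,x_0$ as above and all $\varepsilon,\delta\in(0,1)$ the algorithm always returns a unit vector $x$, and $$\Pr\big[x^\top\Sigma x\ge(1-\varepsilon)\lambda_1\big]\ge 1-\delta .$$ The number $N$ of samples used always satisfies $$N\le C\,\frac{v(\mathcal D)}{\mathrm{gap}}\left(\frac{\log(1/\delta)+\max\{0,\log\log(1/\varepsilon)\}}{\mathrm{gap}}+\frac1{\delta^2\varepsilon}\right).$$ The processing time is amortized $O(d)$ per sample: the total number of elementary operations (real arithmetic operations, square roots, comparisons, reads of a coordinate of a sample, random draws) is always at most $C\,d\,(N+1)$. The choice of the parameters by the rule is not counted in the running time. -/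

import Mathlib

open MeasureTheory

namespace OnlinePCA

/-- Vectors of `ℝ^d` with the Euclidean norm. -/
abbrev Vec (d : ℕ) : Type := EuclideanSpace ℝ (Fin d)

section Spectral

variable {d : ℕ}

/-- The matrix `E[a aᵀ]` with `a ∼ D`. -/
noncomputable def secondMoment (D : Measure (Vec d)) : Matrix (Fin d) (Fin d) ℝ :=
  Matrix.of fun i j => ∫ a, (Matrix.vecMulVec (⇑a) (⇑a)) i j ∂D

/-- The matrix `E[(a aᵀ)²]` with `a ∼ D`. -/
noncomputable def fourthMoment (D : Measure (Vec d)) : Matrix (Fin d) (Fin d) ℝ :=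
  Matrix.of fun i j => ∫ a, (Matrix.vecMulVec (⇑a) (⇑a) ^ 2) i j ∂D

/-- `Σ = E[a aᵀ]` as an operator on Euclidean space. -/
noncomputable def Sigma (D : Measure (Vec d)) : Vec d →L[ℝ] Vec d :=
  Matrix.toEuclideanCLM (n := Fin d) (𝕜 := ℝ) (secondMoment D)

theorem Sigma_isSymmetric (D : Measure (Vec d)) :
    (Sigma D : Vec d →ₗ[ℝ] Vec d).IsSymmetric := by
  have h : (secondMoment D).IsHermitian := by
    ext i j
    simp [secondMoment, Matrix.vecMulVec_apply, mul_comm]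
  exact Matrix.isSymmetric_toEuclideanLin_iff.mpr h

/-- The eigenvalues of `Σ` in decreasing order, with multiplicity; `eig D 0` is `λ₁` and
`eig D 1` is `λ₂`. -/
noncomputable def eig (D : Measure (Vec d)) : Fin d → ℝ :=
  (Sigma_isSymmetric D).eigenvalues finrank_euclideanSpace_fin

/-- `λ₁(Σ)`. -/
noncomputable def lam1 (hd : 2 ≤ d) (D : Measure (Vec d)) : ℝ := eig D ⟨0, by omega⟩

/-- `λ₂(Σ)`. -/
noncomputable def lam2 (hd : 2 ≤ d) (D : Measure (Vec d)) : ℝ := eig D ⟨1, by omega⟩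

/-- The relative eigenvalue gap `(λ₁ - λ₂) / λ₁`. -/
noncomputable def gap (hd : 2 ≤ d) (D : Measure (Vec d)) : ℝ :=
  (lam1 hd D - lam2 hd D) / lam1 hd D

/-- The variance parameter `v(D) = ‖E[(a aᵀ)²]‖₂ / ‖E[a aᵀ]‖₂²` (operator norms). -/
noncomputable def nvar (D : Measure (Vec d)) : ℝ :=
  ‖Matrix.toEuclideanCLM (n := Fin d) (𝕜 := ℝ) (fourthMoment D)‖ / ‖Sigma D‖ ^ 2

/-- `‖x‖_B = √(xᵀ B x)` for `B = lam • I - Σ`. -/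
noncomputable def bNorm (D : Measure (Vec d)) (lam : ℝ) (x : Vec d) : ℝ :=
  Real.sqrt (inner ℝ x (lam • x - Sigma D x))

/-- The potential `G(x) = ‖P_{v₁^⊥} x‖_B / ‖P_{v₁} x‖_B`, for a unit vector `v1`. It is meaningful
when `P_{v₁} x ≠ 0`. -/
noncomputable def potential (D : Measure (Vec d)) (lam : ℝ) (v1 x : Vec d) : ℝ :=
  bNorm D lam (x - inner ℝ v1 x • v1) / bNorm D lam (inner ℝ v1 x • v1)

end Spectral

section CostModel

/-- Resources used so far: samples read from the stream, random seeds used, and elementary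
operations (real arithmetic, square roots, comparisons, reading one coordinate of a sample). -/
structure Counters where
  samples : ℕ
  seeds : ℕ
  time : ℕ

/-- The random input: a stream of samples from the distribution, and a stream of random seeds. -/
abbrev Tape (d : ℕ) : Type := (ℕ → Vec d) × (ℕ → unitInterval)

/-- Streaming randomized programs: given the tape and the current counters, return a value and
the new counters. The tape is read only through `nextSample` and `uniformUpTo`, forwards. -/
def Alg (d : ℕ) (α : Type) : Type := Tape d → Counters → α × Counters

instance (d : ℕ) : Monad (Alg d) where
  pure x := fun _ c => (x, c)
  bind p f := fun ω c => f (p ω c).1 ω (p ω c).2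

variable {d : ℕ} {α : Type}

/-- Return a value computed with `n` elementary operations. -/
def tick (n : ℕ) (x : α) : Alg d α := fun _ c => (x, { c with time := c.time + n })

/-- Read the next sample of the stream: one sample, `d` operations. -/
def nextSample : Alg d (Vec d) := fun ω c =>
  (ω.1 c.samples, { c with samples := c.samples + 1, time := c.time + d })

/-- Draw a fresh integer uniformly from `{1, …, m}` (for `m ≥ 1`): one operation. -/
noncomputable def uniformUpTo (m : ℕ) : Alg d ℕ := fun ω c =>
  (min m (⌊(ω.2 c.seeds : ℝ) * m⌋₊ + 1), { c with seeds := c.seeds + 1, time := c.time + 1 })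

noncomputable def zeroV : Alg d (Vec d) := tick d 0
noncomputable def addV (x y : Vec d) : Alg d (Vec d) := tick d (x + y)
noncomputable def subV (x y : Vec d) : Alg d (Vec d) := tick d (x - y)
noncomputable def scaleV (t : ℝ) (x : Vec d) : Alg d (Vec d) := tick d (t • x)
noncomputable def dotV (x y : Vec d) : Alg d ℝ := tick (2 * d) (inner ℝ x y)

/-- Run `f` in a loop `n` times; one operation of overhead per turn. -/
def loop : ℕ → (α → Alg d α) → α → Alg d α
  | 0, _, s => pure s
  | n + 1, f, s => do
      let s' ← f s
      let s'' ← tick 1 s'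
      loop n f s''

/-- Run `f` in a loop along a list of parameters; one operation of overhead per turn. -/
def loopList {β : Type} : List β → (β → α → Alg d α) → α → Alg d α
  | [], _, s => pure s
  | p :: ps, f, s => do
      let s' ← f p s
      let s'' ← tick 1 s'
      loopList ps f s''

/-- The entry of index `⌊n/2⌋` (from `0`) of the sorted list of the `n` given numbers. -/
noncomputable def medianOf (l : List ℝ) : ℝ :=
  (l.insertionSort (· ≤ ·)).getD (l.length / 2) 0

/-- The median through insertion sort: at most `n²` comparisons and moves. -/
noncomputable def medianA (l : List ℝ) : Alg d ℝ := tick (l.length ^ 2 + 1) (medianOf l)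

end CostModel

section Algorithm

variable {d : ℕ}

/-- Parameters of one streaming SVRG step: step size (the ratio `η / L`), number `k` of samples for
the average gradient, bound `m` on the number of inner steps. -/
structure SvrgParams where
  stepSize : ℝ
  k : ℕ
  m : ℕ
  stepSize_pos : 0 < stepSize
  k_pos : 0 < k
  m_pos : 0 < m

/-- Parameters of one round of the shifted-and-inverted power method: the streaming SVRG steps of
the linear system solve, and, for the median-of-means estimate of the Rayleigh quotient, the
batch size and the number of batches. -/
structure RoundParams where
  svrg : List SvrgParams
  batchSize : ℕ
  batches : ℕ
  batchSize_pos : 0 < batchSize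
  batches_pos : 0 < batches

/-- `∇ψ_a(y) = (lam • I - a aᵀ) y - b`, for `ψ_a(y) = ½ yᵀ (lam • I - a aᵀ) y - bᵀ y`. -/
noncomputable def gradPsi (lam : ℝ) (b a y : Vec d) : Alg d (Vec d) := do
  let t ← dotV a y
  let p ← scaleV lam y
  let q ← scaleV t a
  let r ← subV p q
  subV r b

/-- One streaming SVRG step for the system `B y = b`, started at `y0`: average `∇ψ_a(y0)` over `k`
samples to get `g`, draw `n` uniformly from `{1, …, m}`, and make `n` updates
`y ← y - stepSize • (∇ψ_a(y) - ∇ψ_a(y0) + g)`, each with a fresh sample `a`. -/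
noncomputable def ssvrgIter (lam : ℝ) (b : Vec d) (p : SvrgParams) (y0 : Vec d) :
    Alg d (Vec d) := do
  let z ← zeroV
  let s ← loop p.k (fun s => do
    let a ← nextSample
    let h ← gradPsi lam b a y0
    addV s h) z
  let w ← tick 1 (1 / (p.k : ℝ))
  let g ← scaleV w s
  let n ← uniformUpTo p.m
  loop n (fun y => do
    let a ← nextSample
    let h ← gradPsi lam b a y
    let h0 ← gradPsi lam b a y0
    let u ← subV h h0
    let v ← addV u g
    let e ← scaleV p.stepSize v
    subV y e) y0

/-- Approximate `B⁻¹ b`: streaming SVRG steps, one after the other, started at `0`. -/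
noncomputable def solve (lam : ℝ) (ps : List SvrgParams) (b : Vec d) : Alg d (Vec d) := do
  let z ← zeroV
  loopList ps (fun p y => ssvrgIter lam b p y) z

/-- The mean of `(aᵀ u)²` over `k` fresh samples `a`. -/
noncomputable def batchMean (k : ℕ) (u : Vec d) : Alg d ℝ := do
  let s ← loop k (fun s : ℝ => do
    let a ← nextSample
    let t ← dotV a u
    tick 2 (s + t ^ 2)) 0
  tick 1 (s / k)

/-- Median-of-means estimate of `uᵀ Σ u` for a unit vector `u`: `n` batches of size `k`. -/
noncomputable def rayQuot (k n : ℕ) (u : Vec d) : Alg d ℝ := do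
  let l ← loop n (fun l : List ℝ => do
    let r ← batchMean k u
    tick 1 (r :: l)) []
  medianA l

/-- The Euclidean norm. -/
noncomputable def normA (x : Vec d) : Alg d ℝ := do
  let s ← dotV x x
  tick 1 (Real.sqrt s)

/-- The vector `x / ‖x‖`, together with `‖x‖`. -/
noncomputable def normalize (x : Vec d) : Alg d (Vec d × ℝ) := do
  let r ← normA x
  let t ← tick 1 (1 / r)
  let u ← scaleV t x
  pure (u, r)

/-- One round of the approximate shifted-and-inverted power method at the unit vector `x`. With
`xh` the output of the solver on `x`, the new vector is `xh / ‖xh‖` if the estimate of the Rayleigh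
quotient of `xh` is at least `lamHat - (lam - lamHat) / 6` and `‖xh‖ ≥ (2/3) / (lam - lamHat)`;
otherwise it is `x`. -/
noncomputable def powerRound (lam lamHat : ℝ) (p : RoundParams) (x : Vec d) :
    Alg d (Vec d) := do
  let xh ← solve lam p.svrg x
  let u ← normalize xh
  let r ← rayQuot p.batchSize p.batches u.1
  tick 8 (if lamHat - (lam - lamHat) / 6 ≤ r ∧ (2 / 3) / (lam - lamHat) ≤ u.2 then u.1 else x)

/-- The online shifted-and-inverted power method, from `x0`, one round for each entry of `sched`. -/
noncomputable def onlineSI (lam lamHat : ℝ) (sched : List RoundParams) (x0 : Vec d) :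
    Alg d (Vec d) := do
  let u ← normalize x0
  loopList sched (fun p x => powerRound lam lamHat p x) u.1

/-- The law of the tape: independent samples from `D`, and independent uniform seeds in `[0, 1]`
that are independent of the samples. -/
noncomputable def tapeLaw (D : Measure (Vec d)) [IsProbabilityMeasure D] : Measure (Tape d) :=
  (Measure.infinitePi fun _ : ℕ => D).prod
    (Measure.infinitePi fun _ : ℕ => (volume : Measure unitInterval))

/-- Result of a run of the method on the tape `ω`: the output vector and the resources used. -/
noncomputable def run (lam lamHat : ℝ) (sched : List RoundParams) (x0 : Vec d) (ω : Tape d) :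
    Vec d × Counters :=
  onlineSI lam lamHat sched x0 ω ⟨0, 0, 0⟩

end Algorithm

end OnlinePCA

/-! Write `Δ = lam - lamHat`, which is comparable to `lam - λ₁` and, unlike it, known to the rule.
The operator `B = lam • I - Σ` splits along `v1` and its complement: it equals `lam - λ₁` on `v1`
and is at least `100 (lam - λ₁)` on the complement. Exact inverse iteration therefore divides the
squared potential by `10⁴`, and a solver error of relative size `g / 100`, with `g` the current
bound on the squared potential, still leaves a division by `4` (`ShiftHyp.approx_step`). A squared
potential `g` costs at most `g (lam - λ₁)` in the Rayleigh quotient, so `T ≈ log₄ (Δ / (lam ε))`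
rounds suffice.

The system `B y = x` is solved by SVRG on a quadratic with strong convexity `Δ` and mean-square
smoothness of order `S = v lam² / Δ`. One SVRG step brings the expected energy error to at most a
quarter of its value, plus a noise term proportional to `1 / k` (`SolverHyp.expect_ssvrgIter_le`).
Doubling `k` from step to step gives error `2⁻ⁿ` after `n` steps, for `O(2ⁿ S / Δ)` samples
(`SolverHyp.expect_solve_le`, `solveSamples_le`).

Failure of a round is bounded by Markov for the solver and Chebyshev for the Rayleigh estimate,
without amplification, so one batch per round is enough and the median is trivial. Round `i` uses
`n₀ + T + i` SVRG steps with `2 ^ n₀ ≥ 4096 / δ`. Its failure probability is of order `4ⁱ / 2 ^ (n₀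
+ T + i)`, and the geometric sum over the rounds is below `δ` (`SolverHyp.expect_rounds_le`). The
sample count is of order `2 ^ n₀ 4ᵀ S / Δ`, that is `v / (gap δ ε)`, so the logarithms of the stated
bound are not needed.

Probabilities are computed by treating programs as a Markov process on the tape: `Streaming` says
that the unread tape is independent of the result so far, and `expect_bind` turns sequencing into
iterated expectation. Unit norm, sample count and running time are checked on every tape. -/

namespace OnlinePCA

/-! ### Programs on a random tape: independence of the unread part, and iterated expectations. -/

section Framework

open scoped ENNReal

variable {d : ℕ}

/-- The componentwise sum of two counters. -/
def Counters.add (c c' : Counters) : Counters :=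
  ⟨c.samples + c'.samples, c.seeds + c'.seeds, c.time + c'.time⟩

/-- The part of the tape that is still unread at the counters `c`. -/
def Tape.shift (c : Counters) (ω : Tape d) : Tape d :=
  (fun n => ω.1 (c.samples + n), fun n => ω.2 (c.seeds + n))

theorem Tape.shift_zero (t : ℕ) (ω : Tape d) : Tape.shift ⟨0, 0, t⟩ ω = ω := by
  simp [Tape.shift]

theorem Tape.shift_shift (c c' : Counters) (ω : Tape d) :
    Tape.shift c' (Tape.shift c ω) = Tape.shift (c.add c') ω := by
  simp [Tape.shift, Counters.add, add_assoc]

theorem measurable_shift {γ : Type*} [MeasurableSpace γ] {c : γ → Counters} {ω : γ → Tape d}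
    (h1 : Measurable fun x => (c x).samples) (h2 : Measurable fun x => (c x).seeds)
    (hω : Measurable ω) : Measurable fun x => Tape.shift (c x) (ω x) := by
  have key : ∀ {X : Type} [MeasurableSpace X] (n : ℕ),
      Measurable fun q : ℕ × (ℕ → X) => q.2 (q.1 + n) := fun n =>
    measurable_from_prod_countable_right fun k => measurable_pi_apply (k + n)
  refine Measurable.prodMk ?_ ?_
  · exact measurable_pi_lambda _ fun n => (key n).comp (h1.prodMk hω.fst)
  · exact measurable_pi_lambda _ fun n => (key n).comp (h2.prodMk hω.snd)

/-- The head and the tail of an i.i.d. sequence are independent. Prepending a head maps `μ.prod μ^ℕ`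
to `μ^ℕ`, because the two measures agree on finite boxes, and these determine an infinite product.
-/
theorem lintegral_infinitePi_cons {X : Type*} [MeasurableSpace X] (μ : Measure X)
    [IsProbabilityMeasure μ] {H : X × (ℕ → X) → ℝ≥0∞} (hH : Measurable H) :
    ∫⁻ ω, H (ω 0, fun n => ω (n + 1)) ∂(Measure.infinitePi fun _ : ℕ => μ) =
      ∫⁻ a, ∫⁻ ω, H (a, ω) ∂(Measure.infinitePi fun _ : ℕ => μ) ∂μ := by
  have hc : Measurable fun q : X × (ℕ → X) => (fun n : ℕ => Nat.casesOn n q.1 q.2 : ℕ → X) := by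
    refine measurable_pi_lambda _ fun n => ?_
    cases n with
    | zero => exact measurable_fst
    | succ n => exact (measurable_pi_apply n).comp measurable_snd
  have hmap : (μ.prod (Measure.infinitePi fun _ : ℕ => μ)).map
      (fun q : X × (ℕ → X) => (fun n : ℕ => Nat.casesOn n q.1 q.2 : ℕ → X)) =
      Measure.infinitePi fun _ : ℕ => μ := by
    refine Measure.eq_infinitePi _ fun s t ht => ?_
    rw [Measure.map_apply hc (MeasurableSet.pi s.countable_toSet fun i _ => ht i)]
    classical
    have hs : (fun q : X × (ℕ → X) => (fun n : ℕ => Nat.casesOn n q.1 q.2 : ℕ → X)) ⁻¹'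
        Set.pi (s : Set ℕ) t = (if 0 ∈ s then t 0 else Set.univ) ×ˢ
          Set.pi ((s.preimage Nat.succ (Nat.succ_injective.injOn) : Finset ℕ) : Set ℕ)
            (fun n => t (n + 1)) := by
      ext ⟨a, w⟩
      simp only [Set.mem_preimage, Set.mem_pi, Set.mem_prod, Finset.mem_coe, Finset.mem_preimage]
      constructor
      · intro h
        refine ⟨?_, fun n hn => h (n + 1) hn⟩
        split_ifs with h0
        · exact h 0 h0
        · trivial
      · rintro ⟨h0, h1⟩ n hn
        cases n with
        | zero => simpa [hn] using h0
        | succ n => exact h1 n hn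
    rw [hs, Measure.prod_prod, Measure.infinitePi_pi _ fun i _ => ht (i + 1)]
    by_cases h0 : 0 ∈ s
    · rw [if_pos h0, ← Finset.mul_prod_erase s _ h0]
      congr 1
      refine Finset.prod_bij (fun n _ => n + 1) ?_ ?_ ?_ ?_
      · intro n hn
        simpa using hn
      · intro a _ b _ h
        simpa using h
      · intro n hn
        obtain ⟨hn0, hns⟩ := Finset.mem_erase.mp hn
        obtain ⟨k, rfl⟩ := Nat.exists_eq_succ_of_ne_zero hn0
        exact ⟨k, by simpa using hns, rfl⟩
      · intro n _
        rfl
    · rw [if_neg h0, measure_univ, one_mul]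
      refine Finset.prod_bij (fun n _ => n + 1) ?_ ?_ ?_ ?_
      · intro n hn
        simpa using hn
      · intro a _ b _ h
        simpa using h
      · intro n hns
        obtain ⟨k, rfl⟩ := Nat.exists_eq_succ_of_ne_zero (fun h => h0 (h ▸ hns))
        exact ⟨k, by simpa using hns, rfl⟩
      · intro n _
        rfl
  have hH' : Measurable fun ω : ℕ → X => H (ω 0, fun n => ω (n + 1)) := by
    refine hH.comp ((measurable_pi_apply 0).prodMk ?_)
    exact measurable_pi_lambda _ fun n => measurable_pi_apply (n + 1)
  conv_lhs => rw [← hmap]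
  rw [lintegral_map hH' hc]
  exact lintegral_prod _ hH.aemeasurable

instance (D : Measure (Vec d)) [IsProbabilityMeasure D] : IsProbabilityMeasure (tapeLaw D) := by
  unfold tapeLaw; infer_instance

/-- A family of programs that reads the tape only forwards from the current position, measurably,
and whose result is independent of the rest of the tape. -/
structure Streaming (D : Measure (Vec d)) [IsProbabilityMeasure D] {β α : Type}
    [MeasurableSpace β] [MeasurableSpace α] (p : β → Alg d α) : Prop where
  equivariant : ∀ b ω c, p b ω c =
    ((p b (Tape.shift c ω) ⟨0, 0, 0⟩).1, c.add (p b (Tape.shift c ω) ⟨0, 0, 0⟩).2)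
  measurable_val : Measurable fun q : β × Tape d => (p q.1 q.2 ⟨0, 0, 0⟩).1
  measurable_samples : Measurable fun q : β × Tape d => (p q.1 q.2 ⟨0, 0, 0⟩).2.samples
  measurable_seeds : Measurable fun q : β × Tape d => (p q.1 q.2 ⟨0, 0, 0⟩).2.seeds
  fresh : ∀ b, ∀ G : α × Tape d → ℝ≥0∞, Measurable G →
    ∫⁻ ω, G ((p b ω ⟨0, 0, 0⟩).1, Tape.shift (p b ω ⟨0, 0, 0⟩).2 ω) ∂(tapeLaw D) =
      ∫⁻ ω, ∫⁻ ω', G ((p b ω ⟨0, 0, 0⟩).1, ω') ∂(tapeLaw D) ∂(tapeLaw D)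

/-- The expectation of `F` at the result of the program `p` on a fresh tape. -/
noncomputable def expect (D : Measure (Vec d)) [IsProbabilityMeasure D] {α : Type}
    (p : Alg d α) (F : α → ℝ≥0∞) : ℝ≥0∞ := ∫⁻ ω, F (p ω ⟨0, 0, 0⟩).1 ∂(tapeLaw D)

variable {D : Measure (Vec d)} [IsProbabilityMeasure D] {α β γ : Type}

theorem bind_apply (p : Alg d α) (f : α → Alg d γ) (ω : Tape d) (c : Counters) :
    (p >>= f) ω c = f (p ω c).1 ω (p ω c).2 := rfl

theorem expect_tick (n : ℕ) (x : α) (F : α → ℝ≥0∞) : expect D (tick n x) F = F x := by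
  simp [expect, tick]

theorem expect_pure (x : α) (F : α → ℝ≥0∞) : expect D (pure x) F = F x :=
  expect_tick 0 x F

theorem expect_mono {p : Alg d α} {F G : α → ℝ≥0∞} (h : ∀ x, F x ≤ G x) :
    expect D p F ≤ expect D p G := lintegral_mono fun _ => h _

theorem expect_const_le (p : Alg d α) (c : ℝ≥0∞) : expect D p (fun _ => c) ≤ c := by
  simp [expect]

theorem expect_add_const (p : Alg d α) (F : α → ℝ≥0∞) (c : ℝ≥0∞) :
    expect D p (fun x => F x + c) = expect D p F + c := by
  simp only [expect]
  rw [lintegral_add_right _ measurable_const]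
  simp

variable [MeasurableSpace α] [MeasurableSpace β] [MeasurableSpace γ]

namespace Streaming

theorem comp {p : α → Alg d γ} (hp : Streaming D p) {h : β → α} (hh : Measurable h) :
    Streaming D fun b => p (h b) where
  equivariant b := hp.equivariant (h b)
  measurable_val := hp.measurable_val.comp ((hh.comp measurable_fst).prodMk measurable_snd)
  measurable_samples := hp.measurable_samples.comp ((hh.comp measurable_fst).prodMk measurable_snd)
  measurable_seeds := hp.measurable_seeds.comp ((hh.comp measurable_fst).prodMk measurable_snd)
  fresh b := hp.fresh (h b)

/-- By equivariance the continuation may be restarted with zero counters on the unread tape, which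
is the form to which freshness applies. -/
theorem bind_zero {p : β → Alg d α} {f : β → α → Alg d γ}
    (hf : Streaming D fun q : β × α => f q.1 q.2) (b : β) (ω : Tape d) :
    (p b >>= f b) ω ⟨0, 0, 0⟩ =
      ((f b (p b ω ⟨0, 0, 0⟩).1 (Tape.shift (p b ω ⟨0, 0, 0⟩).2 ω) ⟨0, 0, 0⟩).1,
        (p b ω ⟨0, 0, 0⟩).2.add
          (f b (p b ω ⟨0, 0, 0⟩).1 (Tape.shift (p b ω ⟨0, 0, 0⟩).2 ω) ⟨0, 0, 0⟩).2) := by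
  rw [bind_apply]
  exact hf.equivariant (b, (p b ω ⟨0, 0, 0⟩).1) ω _

theorem bind {p : β → Alg d α} {f : β → α → Alg d γ} (hp : Streaming D p)
    (hf : Streaming D fun q : β × α => f q.1 q.2) : Streaming D fun b => p b >>= f b := by
  have hm : Measurable fun q : β × Tape d => (((q.1, (p q.1 q.2 ⟨0, 0, 0⟩).1),
      Tape.shift (p q.1 q.2 ⟨0, 0, 0⟩).2 q.2) : (β × α) × Tape d) :=
    (measurable_fst.prodMk hp.measurable_val).prodMk
      (measurable_shift hp.measurable_samples hp.measurable_seeds measurable_snd)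
  refine ⟨fun b ω c => ?_, ?_, ?_, ?_, fun b G hG => ?_⟩
  · rw [bind_zero hf, bind_apply, hp.equivariant b ω c]
    dsimp only
    rw [hf.equivariant (b, _) ω _, ← Tape.shift_shift]
    simp [Counters.add, add_assoc]
  · simp only [bind_zero hf]
    exact hf.measurable_val.comp hm
  · simp only [bind_zero hf]
    exact hp.measurable_samples.add (hf.measurable_samples.comp hm)
  · simp only [bind_zero hf]
    exact hp.measurable_seeds.add (hf.measurable_seeds.comp hm)
  · simp only [bind_zero hf, ← Tape.shift_shift]
    have hb : Measurable fun q : α × Tape d => ((b, q.1), q.2) := by fun_prop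
    have hv := hf.measurable_val.comp hb
    have hs := measurable_shift (hf.measurable_samples.comp hb) (hf.measurable_seeds.comp hb)
      (measurable_snd (α := α) (β := Tape d))
    -- Freshness of `p` is used twice: `h1` moves the run of `f` to an independent tape, and `h2`
    -- does the same for the integral on the right-hand side. What remains is freshness of `f` at a
    -- fixed value of `p`.
    have h1 := hp.fresh b (fun q => G ((f b q.1 q.2 ⟨0, 0, 0⟩).1,
      Tape.shift (f b q.1 q.2 ⟨0, 0, 0⟩).2 q.2)) (hG.comp (hv.prodMk hs))
    have hG2 : Measurable fun x : γ => ∫⁻ ω'', G (x, ω'') ∂(tapeLaw D) :=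
      hG.lintegral_prod_right' (ν := tapeLaw D)
    have h2 := hp.fresh b (fun q => ∫⁻ ω'', G ((f b q.1 q.2 ⟨0, 0, 0⟩).1, ω'') ∂(tapeLaw D))
      (hG2.comp hv)
    dsimp only at h1 h2
    rw [h1, h2]
    exact lintegral_congr fun ω => hf.fresh (b, _) G hG

theorem tick (n : ℕ) {h : β → α} (hh : Measurable h) :
    Streaming D fun b => OnlinePCA.tick (d := d) n (h b) where
  equivariant b ω c := by simp [OnlinePCA.tick, Counters.add]
  measurable_val := hh.comp measurable_fst
  measurable_samples := measurable_const
  measurable_seeds := measurable_const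
  fresh b G hG := by simp [OnlinePCA.tick, Tape.shift]

theorem pure {h : β → α} (hh : Measurable h) :
    Streaming D fun b => (Pure.pure (h b) : Alg d α) := tick 0 hh

theorem nextSample : Streaming D fun _ : β => OnlinePCA.nextSample (d := d) where
  equivariant b ω c := by simp [OnlinePCA.nextSample, Counters.add, Tape.shift]
  measurable_val := by
    unfold OnlinePCA.nextSample
    exact (measurable_pi_apply 0).comp (measurable_fst.comp measurable_snd)
  measurable_samples := measurable_const
  measurable_seeds := measurable_const
  fresh b G hG := by
    have hm : Measurable fun q : (Vec d × (ℕ → Vec d)) × (ℕ → unitInterval) =>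
        G (q.1.1, (q.1.2, q.2)) := hG.comp (by fun_prop)
    have hG1 : Measurable fun a : Vec d => ∫⁻ ω', G (a, ω') ∂(tapeLaw D) :=
      hG.lintegral_prod_right' (ν := tapeLaw D)
    have e1 := lintegral_infinitePi_cons D (hm.lintegral_prod_right'
      (ν := Measure.infinitePi fun _ : ℕ => (volume : Measure unitInterval)))
    simp only [OnlinePCA.nextSample, Tape.shift, zero_add, add_comm 1]
    have hm1 : Measurable fun ω : Tape d => G (ω.1 0, ((fun n => ω.1 (n + 1)), ω.2)) :=
      hG.comp (by fun_prop)
    have hm2 : Measurable fun ω : Tape d => ∫⁻ ω', G (ω.1 0, ω') ∂(tapeLaw D) :=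
      hG1.comp (by fun_prop)
    rw [show ∫⁻ ω : Tape d, G (ω.1 0, ((fun n => ω.1 (n + 1)), ω.2)) ∂(tapeLaw D) =
        ∫⁻ s, ∫⁻ t, G (s 0, ((fun n => s (n + 1)), t))
          ∂(Measure.infinitePi fun _ : ℕ => (volume : Measure unitInterval))
          ∂(Measure.infinitePi fun _ : ℕ => D) from lintegral_prod _ hm1.aemeasurable]
    rw [show ∫⁻ ω : Tape d, ∫⁻ ω', G (ω.1 0, ω') ∂(tapeLaw D) ∂(tapeLaw D) =
        ∫⁻ s, ∫⁻ t, ∫⁻ ω', G (s 0, ω') ∂(tapeLaw D)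
          ∂(Measure.infinitePi fun _ : ℕ => (volume : Measure unitInterval))
          ∂(Measure.infinitePi fun _ : ℕ => D) from lintegral_prod _ hm2.aemeasurable]
    refine e1.trans ?_
    simp only [lintegral_const, measure_univ, mul_one]
    have e2 := (measurePreserving_eval_infinitePi (fun _ : ℕ => D) 0).lintegral_comp hG1
    simp only [Function.eval] at e2
    rw [e2]
    refine lintegral_congr fun a => ?_
    exact (lintegral_prod _
      (hG.comp (by fun_prop : Measurable fun ω : Tape d => (a, ω))).aemeasurable).symm

theorem uniformUpTo (m : ℕ) : Streaming D fun _ : β => OnlinePCA.uniformUpTo (d := d) m where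
  equivariant b ω c := by simp [OnlinePCA.uniformUpTo, Counters.add, Tape.shift]
  measurable_val := by
    unfold OnlinePCA.uniformUpTo
    fun_prop
  measurable_samples := measurable_const
  measurable_seeds := measurable_const
  fresh b G hG := by
    simp only [OnlinePCA.uniformUpTo, Tape.shift, zero_add, add_comm 1]
    set φ : unitInterval → ℕ := fun u => min m (⌊(u : ℝ) * m⌋₊ + 1) with hφ
    have hφm : Measurable φ := by unfold φ; fun_prop
    have hm1 : Measurable fun ω : Tape d => G (φ (ω.2 0), (ω.1, fun n => ω.2 (n + 1))) :=
      hG.comp (by fun_prop)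
    have hG1 : Measurable fun u => ∫⁻ ω', G (φ u, ω') ∂(tapeLaw D) :=
      (hG.lintegral_prod_right' (ν := tapeLaw D)).comp hφm
    have hm2 : Measurable fun ω : Tape d => ∫⁻ ω', G (φ (ω.2 0), ω') ∂(tapeLaw D) :=
      hG1.comp (by fun_prop)
    rw [show ∫⁻ ω : Tape d, G (φ (ω.2 0), (ω.1, fun n => ω.2 (n + 1))) ∂(tapeLaw D) =
        ∫⁻ t, ∫⁻ s, G (φ (t 0), (s, fun n => t (n + 1)))
          ∂(Measure.infinitePi fun _ : ℕ => D)
          ∂(Measure.infinitePi fun _ : ℕ => (volume : Measure unitInterval)) from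
      lintegral_prod_symm _ hm1.aemeasurable]
    rw [show ∫⁻ ω : Tape d, ∫⁻ ω', G (φ (ω.2 0), ω') ∂(tapeLaw D) ∂(tapeLaw D) =
        ∫⁻ t, ∫⁻ s, ∫⁻ ω', G (φ (t 0), ω') ∂(tapeLaw D)
          ∂(Measure.infinitePi fun _ : ℕ => D)
          ∂(Measure.infinitePi fun _ : ℕ => (volume : Measure unitInterval)) from
      lintegral_prod_symm _ hm2.aemeasurable]
    have hm : Measurable fun q : (unitInterval × (ℕ → unitInterval)) × (ℕ → Vec d) =>
        G (φ q.1.1, (q.2, q.1.2)) := hG.comp (by fun_prop)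
    refine (lintegral_infinitePi_cons volume
      (hm.lintegral_prod_right' (ν := Measure.infinitePi fun _ : ℕ => D))).trans ?_
    simp only [lintegral_const, measure_univ, mul_one]
    have e2 := (measurePreserving_eval_infinitePi
      (fun _ : ℕ => (volume : Measure unitInterval)) 0).lintegral_comp hG1
    simp only [Function.eval] at e2
    rw [e2]
    refine lintegral_congr fun u => ?_
    exact (lintegral_prod_symm _
      (hG.comp (by fun_prop : Measurable fun ω : Tape d => (φ u, ω))).aemeasurable).symm

theorem loop {f : β → α → Alg d α} (hf : Streaming D fun q : β × α => f q.1 q.2) (n : ℕ)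
    {s : β → α} (hs : Measurable s) : Streaming D fun b => OnlinePCA.loop n (f b) (s b) := by
  have key : ∀ n, Streaming D fun q : β × α => OnlinePCA.loop n (f q.1) q.2 := by
    intro n
    induction n with
    | zero => exact Streaming.pure measurable_snd
    | succ n ih =>
      refine Streaming.bind hf (Streaming.bind (Streaming.tick 1 measurable_snd) ?_)
      exact ih.comp (h := fun q : ((β × α) × α) × α => (q.1.1.1, q.2)) (by fun_prop)
  exact (key n).comp (h := fun b => (b, s b)) (by fun_prop)

/-- The number of turns may itself be random, as in the inner loop of SVRG; since it ranges over a
countable set, measurability follows from that for each fixed number. -/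
theorem loop_nat {f : β → α → Alg d α} (hf : Streaming D fun q : β × α => f q.1 q.2)
    {n : β → ℕ} (hn : Measurable n) {s : β → α} (hs : Measurable s) :
    Streaming D fun b => OnlinePCA.loop (n b) (f b) (s b) := by
  have h := fun n => loop hf n hs
  refine ⟨fun b => (h (n b)).equivariant b, ?_, ?_, ?_, fun b => (h (n b)).fresh b⟩
  · exact (measurable_from_prod_countable_right (f := fun q : ℕ × (β × Tape d) =>
      (OnlinePCA.loop q.1 (f q.2.1) (s q.2.1) q.2.2 ⟨0, 0, 0⟩).1)
      fun k => (h k).measurable_val).comp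
      (by fun_prop : Measurable fun q : β × Tape d => (n q.1, q))
  · exact (measurable_from_prod_countable_right (f := fun q : ℕ × (β × Tape d) =>
      (OnlinePCA.loop q.1 (f q.2.1) (s q.2.1) q.2.2 ⟨0, 0, 0⟩).2.samples)
      fun k => (h k).measurable_samples).comp
      (by fun_prop : Measurable fun q : β × Tape d => (n q.1, q))
  · exact (measurable_from_prod_countable_right (f := fun q : ℕ × (β × Tape d) =>
      (OnlinePCA.loop q.1 (f q.2.1) (s q.2.1) q.2.2 ⟨0, 0, 0⟩).2.seeds)
      fun k => (h k).measurable_seeds).comp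
      (by fun_prop : Measurable fun q : β × Tape d => (n q.1, q))

theorem loopList {δ : Type} (ps : List δ) {f : β → δ → α → Alg d α}
    (hf : ∀ p, Streaming D fun q : β × α => f q.1 p q.2)
    {s : β → α} (hs : Measurable s) : Streaming D fun b => OnlinePCA.loopList ps (f b) (s b) := by
  have key : Streaming D fun q : β × α => OnlinePCA.loopList ps (f q.1) q.2 := by
    induction ps with
    | nil => exact Streaming.pure measurable_snd
    | cons p ps ih =>
      refine Streaming.bind (hf p) (Streaming.bind (Streaming.tick 1 measurable_snd) ?_)
      exact ih.comp (h := fun q : ((β × α) × α) × α => (q.1.1.1, q.2)) (by fun_prop)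
  exact key.comp (h := fun b => (b, s b)) (by fun_prop)

end Streaming

/-- The tower rule: the continuation runs on tape that is independent of the result of `p`. -/
theorem expect_bind {p : Alg d α} {f : α → Alg d γ} (hp : Streaming D fun _ : Unit => p)
    (hf : Streaming D f) {F : γ → ℝ≥0∞} (hF : Measurable F) :
    expect D (p >>= f) F = expect D p fun x => expect D (f x) F := by
  have hf' : Streaming D fun q : Unit × α => (fun _ : Unit => f) q.1 q.2 := hf.comp measurable_snd
  have h := hp.fresh () (fun q : α × Tape d => F (f q.1 q.2 ⟨0, 0, 0⟩).1)
    (hF.comp hf.measurable_val)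
  simp only [expect]
  dsimp only at h
  rw [← h]
  refine lintegral_congr fun ω => ?_
  exact congrArg (fun r => F r.1) (Streaming.bind_zero (D := D)
    (p := fun _ : Unit => p) (f := fun _ : Unit => f) hf' () ω)

theorem measurable_expect {f : β → Alg d γ} (hf : Streaming D f) {F : γ → ℝ≥0∞}
    (hF : Measurable F) : Measurable fun b => expect D (f b) F :=
  (hF.comp hf.measurable_val).lintegral_prod_right' (ν := tapeLaw D)

theorem expect_nextSample {F : Vec d → ℝ≥0∞} (hF : Measurable F) :
    expect D nextSample F = ∫⁻ a, F a ∂D := by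
  have hm : Measurable fun ω : Tape d => F (ω.1 0) := hF.comp (by fun_prop)
  have e2 := (measurePreserving_eval_infinitePi (fun _ : ℕ => D) 0).lintegral_comp hF
  simp only [Function.eval] at e2
  rw [← e2]
  refine (lintegral_prod _ hm.aemeasurable).trans ?_
  simp

theorem expect_const_mul {p : Alg d α} (hp : Streaming D fun _ : Unit => p) {F : α → ℝ≥0∞}
    (hF : Measurable F) (c : ℝ≥0∞) :
    expect D p (fun x => c * F x) = c * expect D p F := by
  simp only [expect]
  exact lintegral_const_mul _
    (hF.comp (hp.measurable_val.comp (by fun_prop : Measurable fun ω : Tape d => ((), ω))))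

/-- The event lies in the interval from `(j - 1) / m` to `j / m`. An upper bound is all that
expectations of nonnegative errors require. -/
theorem volume_uniform_le {m : ℕ} (hm : 0 < m) (j : ℕ) :
    (volume : Measure unitInterval) {u | min m (⌊(u : ℝ) * m⌋₊ + 1) = j} ≤
      ENNReal.ofReal (1 / m) := by
  have hm' : (0 : ℝ) < m := by exact_mod_cast hm
  rcases isEmpty_or_nonempty
      {u : unitInterval // min m (⌊(u : ℝ) * m⌋₊ + 1) = j} with he | ⟨⟨u₀, hu₀⟩⟩
  · have : {u : unitInterval | min m (⌊(u : ℝ) * m⌋₊ + 1) = j} = ∅ := by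
      ext u
      simp only [Set.mem_ofPred_eq, Set.mem_empty_iff_false, iff_false]
      exact fun h => he.false ⟨u, h⟩
    rw [this]; simp
  have hj1 : 1 ≤ j := by omega
  have hjm : j ≤ m := by omega
  have hjm' : (j : ℝ) ≤ m := by exact_mod_cast hjm
  have hj1' : (1 : ℝ) ≤ j := by exact_mod_cast hj1
  have hx : ((j : ℝ) - 1) / m ∈ unitInterval :=
    ⟨div_nonneg (by linarith) hm'.le, by rw [div_le_one hm']; linarith⟩
  have hy : (j : ℝ) / m ∈ unitInterval :=
    ⟨by positivity, by rw [div_le_one hm']; linarith⟩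
  have hsub : {u : unitInterval | min m (⌊(u : ℝ) * m⌋₊ + 1) = j} ⊆
      Set.Icc (⟨_, hx⟩ : unitInterval) ⟨_, hy⟩ := by
    intro u hu
    simp only [Set.mem_ofPred_eq] at hu
    have hu0 : 0 ≤ (u : ℝ) * m := mul_nonneg u.2.1 hm'.le
    have hu1 : (u : ℝ) * m ≤ m := by nlinarith [u.2.2]
    constructor
    · change ((j : ℝ) - 1) / m ≤ u
      rw [div_le_iff₀ hm']
      have : j ≤ ⌊(u : ℝ) * m⌋₊ + 1 := by omega
      have h2 : (j : ℝ) ≤ ⌊(u : ℝ) * m⌋₊ + 1 := by exact_mod_cast this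
      linarith [Nat.floor_le hu0]
    · change (u : ℝ) ≤ (j : ℝ) / m
      rw [le_div_iff₀ hm']
      -- The cap at `m` changes the value only at the seed `u = 1`.
      rcases le_total m (⌊(u : ℝ) * m⌋₊ + 1) with h | h
      · rw [min_eq_left h] at hu
        rw [← hu]; exact hu1
      · rw [min_eq_right h] at hu
        rw [← hu]; push_cast
        exact (Nat.lt_floor_add_one _).le
  refine (measure_mono hsub).trans ?_
  rw [unitInterval.volume_Icc]
  refine ENNReal.ofReal_le_ofReal (le_of_eq ?_)
  change (j : ℝ) / m - ((j : ℝ) - 1) / m = 1 / m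
  ring

theorem expect_uniformUpTo_le {m : ℕ} (hm : 0 < m) (F : ℕ → ℝ≥0∞) :
    expect D (uniformUpTo m) F ≤
      ENNReal.ofReal (1 / m) * ∑ j ∈ Finset.range m, F (j + 1) := by
  set φ : unitInterval → ℕ := fun u => min m (⌊(u : ℝ) * m⌋₊ + 1) with hφ
  have hφm : Measurable φ := by unfold φ; fun_prop
  have hF1 : Measurable fun u => F (φ u) := (measurable_from_nat (f := F)).comp hφm
  have e2 := (measurePreserving_eval_infinitePi
      (fun _ : ℕ => (volume : Measure unitInterval)) 0).lintegral_comp hF1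
  simp only [Function.eval] at e2
  have hm1 : Measurable fun ω : Tape d => F (φ (ω.2 0)) := hF1.comp (by fun_prop)
  have e1 : expect D (uniformUpTo m) F = ∫⁻ u, F (φ u) ∂(volume : Measure unitInterval) := by
    rw [← e2]
    refine (lintegral_prod _ hm1.aemeasurable).trans ?_
    simp [φ]
  rw [e1, Finset.mul_sum]
  have hpt : ∀ u, F (φ u) = ∑ j ∈ Finset.range m,
      Set.indicator {u | φ u = j + 1} (fun _ => F (j + 1)) u := by
    intro u
    have h1 : 1 ≤ φ u := by simp only [hφ]; omega
    have h2 : φ u ≤ m := by simp only [hφ]; omega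
    rw [Finset.sum_eq_single (φ u - 1)]
    · rw [Set.indicator_of_mem (by simp only [Set.mem_ofPred_eq]; omega), Nat.sub_add_cancel h1]
    · intro j _ hj
      exact Set.indicator_of_notMem (by simp only [Set.mem_ofPred_eq]; omega) _
    · intro h
      simp only [Finset.mem_range] at h
      omega
  have hms : ∀ j, MeasurableSet {u | φ u = j} := fun j => hφm (measurableSet_singleton j)
  simp only [hpt]
  rw [lintegral_finsetSum _ fun j _ => measurable_const.indicator (hms (j + 1))]
  refine Finset.sum_le_sum fun j _ => ?_
  rw [lintegral_indicator_const (hms (j + 1)), mul_comm]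
  gcongr
  exact volume_uniform_le hm (j + 1)

end Framework

/-! ### Loops driven by fresh samples: telescoping potentials and the variance of sums. -/

section SampleLoops

open scoped ENNReal

variable {d : ℕ} {α β : Type}

/-- Update the state `s` with a fresh sample, at the cost of `n` further operations. -/
def sampleStep (n : ℕ) (step : Vec d → α → α) (s : α) : Alg d α :=
  nextSample >>= fun a => tick n (step a s)

theorem loop_succ (n : ℕ) (f : α → Alg d α) (s : α) :
    loop (n + 1) f s = f s >>= fun s' => tick 1 s' >>= fun s'' => loop n f s'' := rfl

variable {D : Measure (Vec d)} [IsProbabilityMeasure D] [MeasurableSpace α] [MeasurableSpace β]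

theorem Streaming.sampleStep (n : ℕ) {step : β → Vec d → α → α}
    (h : Measurable fun q : β × Vec d × α => step q.1 q.2.1 q.2.2) :
    Streaming D fun q : β × α => OnlinePCA.sampleStep n (step q.1) q.2 :=
  Streaming.bind Streaming.nextSample (Streaming.tick n
    (h.comp (by fun_prop : Measurable fun q : (β × α) × Vec d => (q.1.1, q.2, q.1.2))))

theorem Streaming.loop_sampleStep (n c : ℕ) {step : Vec d → α → α}
    (h : Measurable fun q : Vec d × α => step q.1 q.2) :
    Streaming D fun s : α => OnlinePCA.loop n (OnlinePCA.sampleStep c step) s := by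
  refine Streaming.loop (f := fun _ : α => OnlinePCA.sampleStep c step) ?_ n measurable_id
  exact Streaming.sampleStep c (step := fun _ : α => step)
    (h.comp (by fun_prop : Measurable fun q : α × Vec d × α => (q.2.1, q.2.2)))

/-- Peeling off the first sample rather than the last allows inductions in which the starting state
is arbitrary. -/
theorem expect_loop_sampleStep_succ (n c : ℕ) {step : Vec d → α → α}
    (h : Measurable fun q : Vec d × α => step q.1 q.2) (s : α) {F : α → ℝ≥0∞}
    (hF : Measurable F) :
    expect D (loop (n + 1) (sampleStep c step) s) F =
      ∫⁻ a, expect D (loop n (sampleStep c step) (step a s)) F ∂D := by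
  have hl := Streaming.loop_sampleStep (D := D) n c h
  have h1 : Streaming D fun s' : α =>
      tick 1 s' >>= fun s'' => loop n (sampleStep c step) s'' :=
    Streaming.bind (Streaming.tick 1 measurable_id)
      (hl.comp (measurable_snd : Measurable fun q : α × α => q.2))
  have hs : Measurable fun a => step a s :=
    h.comp (by fun_prop : Measurable fun a : Vec d => (a, s))
  have h2 : Streaming D fun a : Vec d => tick c (step a s) := Streaming.tick c hs
  have h0 : Streaming D fun _ : Unit => nextSample (d := d) := Streaming.nextSample
  have h3 : Streaming D fun _ : Unit => sampleStep c step s :=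
    Streaming.bind h0 (h2.comp measurable_snd)
  have hm : ∀ s' : α, expect D (tick 1 s' >>= fun s'' => loop n (sampleStep c step) s'') F =
      expect D (loop n (sampleStep c step) s') F := by
    intro s'
    rw [expect_bind (Streaming.tick (D := D) (β := Unit) (h := fun _ => s') 1 measurable_const)
      hl hF, expect_tick]
  rw [loop_succ, expect_bind h3 h1 hF]
  simp only [hm]
  have hG := measurable_expect hl hF
  rw [sampleStep, expect_bind h0 h2 hG]
  simp only [expect_tick]
  exact expect_nextSample (hG.comp hs)

/-- Telescoping of a one-step decrease of the potential `V`. -/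
theorem sum_expect_loop_le (c : ℕ) {step : Vec d → α → α}
    (h : Measurable fun q : Vec d × α => step q.1 q.2) {V W : α → ℝ≥0∞} (hV : Measurable V)
    (hW : Measurable W) {R : ℝ≥0∞} (hR : ∀ y, ∫⁻ a, V (step a y) ∂D + W y ≤ V y + R)
    (n : ℕ) (y : α) :
    ∑ j ∈ Finset.range n, expect D (loop j (sampleStep c step) y) W +
      expect D (loop n (sampleStep c step) y) V ≤ V y + n * R := by
  induction n generalizing y with
  | zero => simp [loop, expect_pure]
  | succ n ih =>
    have hm : ∀ j {F : α → ℝ≥0∞}, Measurable F →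
        Measurable fun a => expect D (loop j (sampleStep c step) (step a y)) F :=
      fun j F hF => (measurable_expect (Streaming.loop_sampleStep j c h) hF).comp
        (h.comp (by fun_prop : Measurable fun a : Vec d => (a, y)))
    rw [Finset.sum_range_succ']
    simp only [expect_loop_sampleStep_succ _ c h y hW, expect_loop_sampleStep_succ _ c h y hV]
    have h0 : expect D (loop 0 (sampleStep c step) y) W = W y := expect_pure y W
    rw [h0, ← lintegral_finsetSum _ fun j _ => hm j hW, add_right_comm,
      ← lintegral_add_left (Finset.measurable_fun_sum _ fun j _ => hm j hW)]
    calc _ ≤ ∫⁻ a, (V (step a y) + n * R) ∂D + W y :=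
          add_le_add (lintegral_mono fun a => ih (step a y)) le_rfl
      _ = (∫⁻ a, V (step a y) ∂D + W y) + n * R := by
          rw [lintegral_add_right _ measurable_const]
          simp only [lintegral_const, measure_univ, mul_one]
          ring
      _ ≤ (V y + R) + n * R := add_le_add (hR y) le_rfl
      _ = _ := by push_cast; ring

section Mean

variable {E : Type} [NormedAddCommGroup E] [InnerProductSpace ℝ E] [CompleteSpace E]

/-- The cross term vanishes because `h a` minus its mean is centred. -/
theorem integral_norm_add_sub_mean_sq {h : Vec d → E} (hh : MemLp h 2 D) (x : E) :
    Integrable (fun a => ‖x + (h a - ∫ a, h a ∂D)‖ ^ 2) D ∧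
    ∫ a, ‖x + (h a - ∫ a, h a ∂D)‖ ^ 2 ∂D =
      ‖x‖ ^ 2 + ∫ a, ‖h a - ∫ a, h a ∂D‖ ^ 2 ∂D := by
  set μ := ∫ a, h a ∂D
  have h2 : MemLp (fun a => h a - μ) 2 D := hh.sub (memLp_const μ)
  have i1 : Integrable (fun a => h a - μ) D := h2.integrable (by norm_num)
  have i2 : Integrable (fun a => ‖h a - μ‖ ^ 2) D :=
    (memLp_two_iff_integrable_sq_norm h2.1).mp h2
  have i3 : Integrable (fun a => 2 * inner ℝ x (h a - μ)) D := (i1.const_inner x).const_mul 2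
  have i4 : Integrable (fun a => ‖x‖ ^ 2 + 2 * inner ℝ x (h a - μ)) D :=
    (integrable_const _).add i3
  simp only [norm_add_sq_real]
  refine ⟨i4.add i2, ?_⟩
  rw [integral_add i4 i2, integral_add (integrable_const _) i3, integral_const_mul,
    integral_inner i1, integral_sub (hh.integrable (by norm_num)) (integrable_const _)]
  simp [μ]

variable [MeasurableSpace E] [BorelSpace E] [SecondCountableTopology E]

/-- The variance of a sum of `n` independent copies of `h a`. -/
theorem expect_loop_sum_le (c : ℕ) {h : Vec d → E} (hm : Measurable h) (hh : MemLp h 2 D)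
    (n : ℕ) (s x : E) :
    expect D (loop n (sampleStep c fun a s => s + h a) s)
        (fun y => ENNReal.ofReal (‖y - (n • (∫ a, h a ∂D) + x)‖ ^ 2)) ≤
      ENNReal.ofReal (‖s - x‖ ^ 2 + n * ∫ a, ‖h a - ∫ a, h a ∂D‖ ^ 2 ∂D) := by
  set μ := ∫ a, h a ∂D with hμ
  set V := ∫ a, ‖h a - μ‖ ^ 2 ∂D with hV
  have hV0 : 0 ≤ V := integral_nonneg fun a => by positivity
  induction n generalizing s x with
  | zero => simp [loop, expect_pure]
  | succ n ih =>
    have hst : Measurable fun q : Vec d × E => q.2 + h q.1 := by fun_prop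
    rw [expect_loop_sampleStep_succ n c hst s (by fun_prop)]
    have e := integral_norm_add_sub_mean_sq hh (s - x)
    rw [← hμ, ← hV] at e
    calc _ ≤ ∫⁻ a, ENNReal.ofReal (‖s - x + (h a - μ)‖ ^ 2 + n * V) ∂D := by
          refine lintegral_mono fun a => ?_
          -- One copy of the mean passes from the target into the shift `x`, so the first sample
          -- contributes exactly its variance.
          have := ih (s + h a) (x + μ)
          rw [show n • μ + (x + μ) = (n + 1) • μ + x by rw [succ_nsmul]; abel,
            show s + h a - (x + μ) = s - x + (h a - μ) by abel] at this
          exact this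
      _ = ENNReal.ofReal (‖s - x‖ ^ 2 + (n + 1 : ℕ) * V) := by
          have i : Integrable (fun a => ‖s - x + (h a - μ)‖ ^ 2 + n * V) D :=
            e.1.add (integrable_const _)
          rw [← ofReal_integral_eq_lintegral_ofReal i
            (Filter.Eventually.of_forall fun a => by simp only [Pi.zero_apply]; positivity),
            integral_add e.1 (integrable_const _), e.2]
          simp only [integral_const, probReal_univ, one_smul]
          push_cast
          congr 1; ring
      _ ≤ _ := le_rfl

theorem expect_loop_mean_le (c : ℕ) {h : Vec d → E} (hm : Measurable h) (hh : MemLp h 2 D)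
    {n : ℕ} (hn : 0 < n) :
    expect D (loop n (sampleStep c fun a s => s + h a) 0)
        (fun y => ENNReal.ofReal (‖(1 / (n : ℝ)) • y - ∫ a, h a ∂D‖ ^ 2)) ≤
      ENNReal.ofReal ((∫ a, ‖h a - ∫ a, h a ∂D‖ ^ 2 ∂D) / n) := by
  have hn' : (n : ℝ) ≠ 0 := by positivity
  have key := expect_loop_sum_le c hm hh n 0 0
  have hst : Measurable fun q : Vec d × E => q.2 + h q.1 := by fun_prop
  set μ := ∫ a, h a ∂D
  have e : ∀ y : E, ENNReal.ofReal (‖(1 / (n : ℝ)) • y - μ‖ ^ 2) =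
      ENNReal.ofReal (1 / (n : ℝ) ^ 2) * ENNReal.ofReal (‖y - (n • μ + 0)‖ ^ 2) := by
    intro y
    rw [← ENNReal.ofReal_mul (by positivity)]
    congr 1
    have : (1 / (n : ℝ)) • y - μ = (1 / (n : ℝ)) • (y - (n • μ + 0)) := by
      rw [add_zero, smul_sub, ← Nat.cast_smul_eq_nsmul ℝ, smul_smul, one_div_mul_cancel hn',
        one_smul]
    rw [this, norm_smul, mul_pow]
    simp
  simp only [e]
  rw [expect_const_mul ((Streaming.loop_sampleStep n c hst).comp measurable_const) (by fun_prop)]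
  refine (mul_le_mul_right key _).trans ?_
  rw [← ENNReal.ofReal_mul (by positivity)]
  refine ENNReal.ofReal_le_ofReal (le_of_eq ?_)
  simp
  field_simp

end Mean

end SampleLoops

/-! ### Moments of the distribution as integrals of `⟪a, w⟫ • a`. -/

section Moments

variable {d : ℕ} {D : Measure (Vec d)}

theorem abs_coord_le_norm (a : Vec d) (i : Fin d) : |a i| ≤ ‖a‖ := by
  simpa using PiLp.norm_apply_le a i

/-- A weighted second moment matrix, as an operator. -/
theorem toEuclideanCLM_moment {ρ : Vec d → ℝ} (hρ : Measurable ρ)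
    (h : Integrable (fun a => |ρ a| * ‖a‖ ^ 2) D) (w : Vec d) :
    Integrable (fun a => (ρ a * inner ℝ a w) • a) D ∧
    Matrix.toEuclideanCLM (n := Fin d) (𝕜 := ℝ)
      (Matrix.of fun i j => ∫ a, ρ a * (a i * a j) ∂D) w = ∫ a, (ρ a * inner ℝ a w) • a ∂D := by
  have hij : ∀ i j, Integrable (fun a : Vec d => ρ a * (a i * a j)) D := by
    intro i j
    refine h.mono' (by fun_prop) (Filter.Eventually.of_forall fun a => ?_)
    rw [Real.norm_eq_abs, abs_mul, abs_mul, sq]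
    gcongr <;> exact abs_coord_le_norm a _
  have hI : Integrable (fun a : Vec d => (ρ a * inner ℝ a w) • a) D := by
    refine (h.mul_const ‖w‖).mono' (by fun_prop) (Filter.Eventually.of_forall fun a => ?_)
    rw [norm_smul, Real.norm_eq_abs, abs_mul]
    calc |ρ a| * |inner ℝ a w| * ‖a‖ ≤ |ρ a| * (‖a‖ * ‖w‖) * ‖a‖ := by
          gcongr; exact abs_real_inner_le_norm a w
      _ = _ := by ring
  refine ⟨hI, ?_⟩
  ext i
  have e := (EuclideanSpace.proj (𝕜 := ℝ) i).integral_comp_comm hI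
  refine Eq.trans ?_ e
  simp only [PiLp.proj_apply]
  rw [Matrix.ofLp_toEuclideanCLM]
  simp only [Matrix.mulVec, dotProduct, Matrix.of_apply]
  simp only [← integral_mul_const]
  rw [← integral_finsetSum _ fun j _ => (hij i j).mul_const _]
  refine integral_congr_ae (Filter.Eventually.of_forall fun a => ?_)
  simp only [PiLp.smul_apply, smul_eq_mul, PiLp.inner_apply, RCLike.inner_apply, conj_trivial]
  rw [Finset.mul_sum, Finset.sum_mul]
  exact Finset.sum_congr rfl fun j _ => by ring

theorem memLp_outer (h4 : Integrable (fun a => ‖a‖ ^ 4) D) (w : Vec d) :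
    MemLp (fun a : Vec d => inner ℝ a w • a) 2 D := by
  rw [memLp_two_iff_integrable_sq_norm (by fun_prop)]
  refine (h4.mul_const (‖w‖ ^ 2)).mono' (by fun_prop) (Filter.Eventually.of_forall fun a => ?_)
  rw [Real.norm_eq_abs, abs_of_nonneg (by positivity), norm_smul, mul_pow, Real.norm_eq_abs]
  calc |inner ℝ a w| ^ 2 * ‖a‖ ^ 2 ≤ (‖a‖ * ‖w‖) ^ 2 * ‖a‖ ^ 2 := by
        gcongr; exact abs_real_inner_le_norm a w
    _ = _ := by ring

/-- Since `(a aᵀ)² = ‖a‖² a aᵀ`, this is a second moment with weight `‖a‖²`. -/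
theorem inner_fourthMoment (h4 : Integrable (fun a => ‖a‖ ^ 4) D) (w : Vec d) :
    inner ℝ w (Matrix.toEuclideanCLM (n := Fin d) (𝕜 := ℝ) (fourthMoment D) w) =
      ∫ a, ‖(inner ℝ a w • a : Vec d)‖ ^ 2 ∂D := by
  have h := toEuclideanCLM_moment (D := D) (ρ := fun a => ‖a‖ ^ 2) (by fun_prop)
    (by simpa only [abs_pow, abs_norm, ← pow_add] using h4) w
  have e : fourthMoment D = Matrix.of fun i j => ∫ a : Vec d, ‖a‖ ^ 2 * (a i * a j) ∂D := by
    ext i j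
    simp only [fourthMoment, Matrix.of_apply]
    refine integral_congr_ae (Filter.Eventually.of_forall fun a => ?_)
    simp only [sq, Matrix.mul_apply, Matrix.vecMulVec_apply]
    rw [← sq, EuclideanSpace.real_norm_sq_eq, Finset.sum_mul]
    exact Finset.sum_congr rfl fun k _ => by ring
  rw [e, h.2, ← integral_inner h.1]
  refine integral_congr_ae (Filter.Eventually.of_forall fun a => ?_)
  simp only [inner_smul_right, real_inner_comm w a, norm_smul, mul_pow, Real.norm_eq_abs, sq_abs]
  ring

/-- For a unit vector, `⟪a, u⟫⁴ ≤ ⟪a, u⟫² ‖a‖²`. Thus the fourth moment operator controls the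
variance of the Rayleigh samples as well as that of the gradients. -/
theorem memLp_inner_sq (h4 : Integrable (fun a => ‖a‖ ^ 4) D) {u : Vec d} (hu : ‖u‖ = 1) :
    MemLp (fun a : Vec d => (inner ℝ a u ^ 2 : ℝ)) 2 D ∧
    ∫ a, ‖(inner ℝ a u ^ 2 : ℝ)‖ ^ 2 ∂D ≤ ∫ a, ‖(inner ℝ a u • a : Vec d)‖ ^ 2 ∂D := by
  have i0 := memLp_outer h4 u
  have i2 : Integrable (fun a : Vec d => ‖(inner ℝ a u • a : Vec d)‖ ^ 2) D :=
    (memLp_two_iff_integrable_sq_norm i0.1).mp i0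
  have hpt : ∀ a : Vec d, ‖(inner ℝ a u ^ 2 : ℝ)‖ ^ 2 ≤ ‖(inner ℝ a u • a : Vec d)‖ ^ 2 := by
    intro a
    have h1 : |inner ℝ a u| ≤ ‖a‖ := by simpa [hu] using abs_real_inner_le_norm a u
    rw [norm_smul, norm_pow, Real.norm_eq_abs, sq |inner ℝ a u|]
    gcongr
  have hL : MemLp (fun a : Vec d => (inner ℝ a u ^ 2 : ℝ)) 2 D := by
    rw [memLp_two_iff_integrable_sq_norm (by fun_prop)]
    refine i2.mono' (by fun_prop) (Filter.Eventually.of_forall fun a => ?_)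
    rw [Real.norm_of_nonneg (by positivity)]
    exact hpt a
  exact ⟨hL, integral_mono ((memLp_two_iff_integrable_sq_norm hL.1).mp hL) i2 hpt⟩

variable [IsProbabilityMeasure D]

theorem integrable_norm_sq (h4 : Integrable (fun a => ‖a‖ ^ 4) D) :
    Integrable (fun a : Vec d => ‖a‖ ^ 2) D := by
  refine (h4.add (integrable_const 1)).mono' (by fun_prop)
    (Filter.Eventually.of_forall fun a => ?_)
  rw [Real.norm_eq_abs, abs_of_nonneg (by positivity)]
  simp only [Pi.add_apply]
  nlinarith [sq_nonneg (‖a‖ ^ 2 - 1)]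

theorem Sigma_eq_integral (h4 : Integrable (fun a => ‖a‖ ^ 4) D) (w : Vec d) :
    Sigma D w = ∫ a, inner ℝ a w • a ∂D := by
  have h := (toEuclideanCLM_moment (D := D) (ρ := fun _ => 1) measurable_const
    (by simpa using integrable_norm_sq h4) w).2
  simp only [one_mul] at h
  rw [← h]
  simp [Sigma, secondMoment, Matrix.vecMulVec_apply]

theorem inner_Sigma (h4 : Integrable (fun a => ‖a‖ ^ 4) D) (w : Vec d) :
    inner ℝ w (Sigma D w) = ∫ a, inner ℝ a w ^ 2 ∂D := by
  rw [Sigma_eq_integral h4, ← integral_inner ((memLp_outer h4 w).integrable (by norm_num))]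
  refine integral_congr_ae (Filter.Eventually.of_forall fun a => ?_)
  simp only [inner_smul_right, real_inner_comm w a]
  ring

theorem inner_Sigma_nonneg (h4 : Integrable (fun a => ‖a‖ ^ 4) D) (w : Vec d) :
    0 ≤ inner ℝ w (Sigma D w) := by
  rw [inner_Sigma h4]
  exact integral_nonneg fun a => sq_nonneg _

/-- Both parts are read off from `E‖h‖² = ‖E h‖² + Var h`, the case where `x` is the mean. -/
theorem norm_integral_sq_le {E : Type} [NormedAddCommGroup E] [InnerProductSpace ℝ E]
    [CompleteSpace E] {h : Vec d → E} (hh : MemLp h 2 D) :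
    ‖∫ a, h a ∂D‖ ^ 2 ≤ ∫ a, ‖h a‖ ^ 2 ∂D ∧
    ∫ a, ‖h a - ∫ a, h a ∂D‖ ^ 2 ∂D ≤ ∫ a, ‖h a‖ ^ 2 ∂D := by
  have h1 := (integral_norm_add_sub_mean_sq hh (∫ a, h a ∂D)).2
  simp only [add_sub_cancel] at h1
  rw [h1]
  constructor
  · have : 0 ≤ ∫ a, ‖h a - ∫ a, h a ∂D‖ ^ 2 ∂D := integral_nonneg fun a => sq_nonneg _
    linarith
  · linarith [sq_nonneg ‖∫ a, h a ∂D‖]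

end Moments

/-! ### One variance-reduced update for a system in `lam • I - Σ`. -/

section Solver

open scoped ENNReal

variable {d : ℕ}

/-- The squared `B`-norm `wᵀ B w`, where `B = lam • I - Σ`. -/
noncomputable def energy (D : Measure (Vec d)) (lam : ℝ) (w : Vec d) : ℝ :=
  inner ℝ w (lam • w - Sigma D w)

/-- The action of `lam • I - a aᵀ`. -/
noncomputable def shiftOuter (lam : ℝ) (a w : Vec d) : Vec d := lam • w - inner ℝ a w • a

theorem shiftOuter_sub (lam : ℝ) (a w w' : Vec d) :
    shiftOuter lam a (w - w') = shiftOuter lam a w - shiftOuter lam a w' := by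
  simp only [shiftOuter, inner_sub_right, smul_sub, sub_smul]; abel

@[fun_prop]
theorem measurable_shiftOuter {γ : Type*} [MeasurableSpace γ] (lam : ℝ) {f g : γ → Vec d}
    (hf : Measurable f) (hg : Measurable g) : Measurable fun x => shiftOuter lam (f x) (g x) := by
  unfold shiftOuter; fun_prop

/-- Assumptions for solving linear systems in `lam • I - Σ` by streaming SVRG. -/
structure SolverHyp (D : Measure (Vec d)) (lam Δ v : ℝ) : Prop where
  moment : Integrable (fun a => ‖a‖ ^ 4) D
  pos : 0 < Δ
  le : Δ ≤ lam
  one_le : 1 ≤ v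
  coercive : ∀ w, Δ * ‖w‖ ^ 2 ≤ energy D lam w
  fourth : ∀ w, ∫ a, ‖(inner ℝ a w • a : Vec d)‖ ^ 2 ∂D ≤ v * lam ^ 2 * ‖w‖ ^ 2

variable {D : Measure (Vec d)} {lam Δ v : ℝ}

theorem SolverHyp.energy_nonneg (H : SolverHyp D lam Δ v) (w : Vec d) : 0 ≤ energy D lam w :=
  (mul_nonneg H.pos.le (sq_nonneg _)).trans (H.coercive w)

variable [IsProbabilityMeasure D]

theorem memLp_shiftOuter (h4 : Integrable (fun a => ‖a‖ ^ 4) D) (w : Vec d) :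
    MemLp (fun a => shiftOuter lam a w) 2 D := (memLp_const (lam • w)).sub (memLp_outer h4 w)

theorem integral_shiftOuter (h4 : Integrable (fun a => ‖a‖ ^ 4) D) (w : Vec d) :
    ∫ a, shiftOuter lam a w ∂D = lam • w - Sigma D w := by
  unfold shiftOuter
  rw [integral_sub (integrable_const _) ((memLp_outer h4 w).integrable (by norm_num)),
    ← Sigma_eq_integral h4]
  simp

/-- Mean-square smoothness. Expanding the square, the deterministic and cross terms are at most `lam
* energy` because `Σ ≥ 0`, and the fourth moment term is at most `(v lam² / Δ) * energy` by
coercivity. Finally `lam ≤ v lam² / Δ`, as `Δ ≤ lam` and `1 ≤ v`. -/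
theorem SolverHyp.integral_norm_shiftOuter_sq_le (H : SolverHyp D lam Δ v) (w : Vec d) :
    ∫ a, ‖shiftOuter lam a w‖ ^ 2 ∂D ≤ 2 * (v * lam ^ 2 / Δ) * energy D lam w := by
  have i0 := memLp_outer H.moment w
  have i1 : Integrable (fun a : Vec d => inner ℝ a w • a) D := i0.integrable (by norm_num)
  have i2 : Integrable (fun a : Vec d => ‖(inner ℝ a w • a : Vec d)‖ ^ 2) D :=
    (memLp_two_iff_integrable_sq_norm i0.1).mp i0
  have i3 : Integrable (fun a : Vec d => 2 * inner ℝ (lam • w) (inner ℝ a w • a : Vec d)) D :=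
    (i1.const_inner _).const_mul 2
  have i4 : Integrable (fun a : Vec d => ‖lam • w‖ ^ 2 -
    2 * inner ℝ (lam • w) (inner ℝ a w • a : Vec d)) D := (integrable_const _).sub i3
  have e : ∫ a, ‖shiftOuter lam a w‖ ^ 2 ∂D = ‖lam • w‖ ^ 2 -
      2 * inner ℝ (lam • w) (Sigma D w) + ∫ a, ‖(inner ℝ a w • a : Vec d)‖ ^ 2 ∂D := by
    simp only [shiftOuter, norm_sub_sq_real]
    rw [integral_add i4 i2, integral_sub (integrable_const _) i3, integral_const_mul,
      integral_inner i1, ← Sigma_eq_integral H.moment]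
    simp
  have hΔ := H.pos
  have hlam : 0 < lam := H.pos.trans_le H.le
  have hE : energy D lam w = lam * ‖w‖ ^ 2 - inner ℝ w (Sigma D w) := by
    simp [energy, inner_sub_right, inner_smul_right]
  have hE0 := H.energy_nonneg w
  have h1 : lam ≤ v * lam ^ 2 / Δ := by
    rw [le_div_iff₀ hΔ]
    nlinarith [H.le, mul_le_mul_of_nonneg_right H.one_le (sq_nonneg lam)]
  have h2 : v * lam ^ 2 * ‖w‖ ^ 2 ≤ v * lam ^ 2 / Δ * energy D lam w := by
    rw [div_mul_eq_mul_div, le_div_iff₀ hΔ, mul_assoc, mul_comm (‖w‖ ^ 2)]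
    exact mul_le_mul_of_nonneg_left (H.coercive w)
      (mul_nonneg (zero_le_one.trans H.one_le) (sq_nonneg lam))
  rw [e, norm_smul, inner_smul_left, mul_pow]
  simp only [Real.norm_eq_abs, sq_abs, conj_trivial]
  have h3 := H.fourth w
  have h4 := mul_le_mul_of_nonneg_right h1 hE0
  have h5 := mul_nonneg hlam.le (inner_Sigma_nonneg H.moment w)
  rw [hE] at *
  nlinarith

theorem norm_sub_add_sub_sq_le (p q r t : Vec d) :
    ‖p - q + (r + t)‖ ^ 2 ≤ 4 * (‖p‖ ^ 2 + ‖q‖ ^ 2 + ‖r‖ ^ 2 + ‖t‖ ^ 2) := by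
  have h : ‖p - q + (r + t)‖ ≤ ‖p‖ + ‖q‖ + (‖r‖ + ‖t‖) :=
    (norm_add_le _ _).trans (add_le_add (norm_sub_le _ _) (norm_add_le _ _))
  have h2 := pow_le_pow_left₀ (norm_nonneg _) h 2
  nlinarith [sq_nonneg (‖p‖ - ‖q‖), sq_nonneg (‖p‖ - ‖r‖), sq_nonneg (‖p‖ - ‖t‖),
    sq_nonneg (‖q‖ - ‖r‖), sq_nonneg (‖q‖ - ‖t‖), sq_nonneg (‖r‖ - ‖t‖)]

/-- One variance-reduced update at the error `e`, with anchor error `e0` and gradient error `z`. -/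
theorem SolverHyp.update_le (H : SolverHyp D lam Δ v) {s : ℝ}
    (hs : s = 1 / (512 * (v * lam ^ 2 / Δ))) (e e0 z : Vec d) :
    ∫⁻ a, ENNReal.ofReal (‖e - s • (shiftOuter lam a e - shiftOuter lam a e0 +
        (lam • e0 - Sigma D e0 + z))‖ ^ 2) ∂D +
      ENNReal.ofReal (s * (63 / 64) * energy D lam e) ≤
    ENNReal.ofReal (‖e‖ ^ 2) +
      ENNReal.ofReal (s * (energy D lam e0 / 32 + 2 * ‖z‖ ^ 2 / Δ)) := by
  have hΔ := H.pos
  have hlam : 0 < lam := H.pos.trans_le H.le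
  set S := v * lam ^ 2 / Δ with hS
  have hSΔ : Δ ≤ S := by
    rw [hS, le_div_iff₀ hΔ]
    nlinarith [H.le, mul_le_mul_of_nonneg_right H.one_le (sq_nonneg lam)]
  have hSpos : 0 < S := hΔ.trans_le hSΔ
  have hs0 : 0 < s := by rw [hs]; positivity
  have hsS : s * S = 1 / 512 := by rw [hs]; field_simp
  have hE := H.energy_nonneg e
  have hE0 := H.energy_nonneg e0
  set r := lam • e0 - Sigma D e0 with hr
  set U : Vec d → Vec d := fun a => shiftOuter lam a e - shiftOuter lam a e0 + (r + z) with hU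
  have l1 := memLp_shiftOuter (lam := lam) H.moment e
  have l0 := memLp_shiftOuter (lam := lam) H.moment e0
  have lU : MemLp U 2 D := (l1.sub l0).add (memLp_const _)
  have sq1 := (memLp_two_iff_integrable_sq_norm l1.1).mp l1
  have sq0 := (memLp_two_iff_integrable_sq_norm l0.1).mp l0
  have sqU := (memLp_two_iff_integrable_sq_norm lU.1).mp lU
  have iU : Integrable U D := lU.integrable (by norm_num)
  have mU : ∫ a, U a ∂D = lam • e - Sigma D e + z := by
    simp only [hU]
    have i10 : Integrable (fun a => shiftOuter lam a e - shiftOuter lam a e0) D :=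
      (l1.integrable (by norm_num)).sub (l0.integrable (by norm_num))
    rw [integral_add i10 (integrable_const _), integral_sub (l1.integrable (by norm_num))
      (l0.integrable (by norm_num)), integral_shiftOuter H.moment, integral_shiftOuter H.moment]
    simp only [integral_const, probReal_univ, one_smul, hr]
    abel
  have iq1 : Integrable (fun a => ‖shiftOuter lam a e‖ ^ 2 + ‖shiftOuter lam a e0‖ ^ 2) D :=
    sq1.add sq0
  have iq2 : Integrable (fun a => ‖shiftOuter lam a e‖ ^ 2 + ‖shiftOuter lam a e0‖ ^ 2 +
    ‖r‖ ^ 2) D := iq1.add (integrable_const _)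
  have bU : ∫ a, ‖U a‖ ^ 2 ∂D ≤ 4 * (2 * S * energy D lam e + 2 * S * energy D lam e0 +
      2 * S * energy D lam e0 + ‖z‖ ^ 2) := by
    have b1 := H.integral_norm_shiftOuter_sq_le e
    have b0 := H.integral_norm_shiftOuter_sq_le e0
    have br : ‖r‖ ^ 2 ≤ 2 * S * energy D lam e0 := by
      have := (norm_integral_sq_le l0).1
      rw [integral_shiftOuter H.moment] at this
      exact this.trans b0
    calc ∫ a, ‖U a‖ ^ 2 ∂D ≤ ∫ a, 4 * (‖shiftOuter lam a e‖ ^ 2 + ‖shiftOuter lam a e0‖ ^ 2 +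
          ‖r‖ ^ 2 + ‖z‖ ^ 2) ∂D :=
        integral_mono sqU ((iq2.add (integrable_const _)).const_mul 4) fun a => norm_sub_add_sub_sq_le _ _ _ _
      _ = 4 * (∫ a, ‖shiftOuter lam a e‖ ^ 2 ∂D + ∫ a, ‖shiftOuter lam a e0‖ ^ 2 ∂D +
          ‖r‖ ^ 2 + ‖z‖ ^ 2) := by
        rw [integral_const_mul, integral_add iq2 (integrable_const _),
          integral_add iq1 (integrable_const _), integral_add sq1 sq0]
        simp
      _ ≤ _ := by linarith
  have isU : Integrable (fun a => s • U a) D := iU.smul s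
  have i3 : Integrable (fun a => 2 * inner ℝ e (s • U a)) D :=
    (isU.const_inner e).const_mul 2
  have i4 : Integrable (fun a => ‖e‖ ^ 2 - 2 * inner ℝ e (s • U a)) D :=
    (integrable_const _).sub i3
  have i5 : Integrable (fun a => ‖s • U a‖ ^ 2) D := by
    simpa only [norm_smul, mul_pow] using sqU.const_mul (‖s‖ ^ 2)
  have i6 : Integrable (fun a => ‖e - s • U a‖ ^ 2) D := by
    simp only [norm_sub_sq_real]
    exact i4.add i5
  have eq : ∫ a, ‖e - s • U a‖ ^ 2 ∂D = ‖e‖ ^ 2 - 2 * (s * (energy D lam e + inner ℝ e z)) +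
      s ^ 2 * ∫ a, ‖U a‖ ^ 2 ∂D := by
    simp only [norm_sub_sq_real]
    rw [integral_add i4 i5, integral_sub (integrable_const _) i3, integral_const_mul,
      integral_inner isU, integral_smul, mU]
    simp only [norm_smul, mul_pow, integral_const_mul, inner_smul_right, inner_add_right, energy]
    simp
  rw [← ofReal_integral_eq_lintegral_ofReal i6
    (Filter.Eventually.of_forall fun a => by simp only [Pi.zero_apply]; positivity),
    ← ENNReal.ofReal_add (integral_nonneg fun a => by positivity) (by positivity),
    ← ENNReal.ofReal_add (by positivity) (by positivity)]
  refine ENNReal.ofReal_le_ofReal ?_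
  rw [eq]
  -- Half of the descent `2 s * energy` is spent on absorbing the gradient error `z`.
  have young : -(2 * inner ℝ e z) ≤ energy D lam e + ‖z‖ ^ 2 / Δ := by
    have h1 := abs_real_inner_le_norm e z
    have h2 := neg_abs_le (inner ℝ e z)
    have h3 := H.coercive e
    have h4 : 2 * (‖e‖ * ‖z‖) ≤ Δ * ‖e‖ ^ 2 + ‖z‖ ^ 2 / Δ := by
      have h5 : Δ * ‖e‖ ^ 2 + ‖z‖ ^ 2 / Δ - 2 * (‖e‖ * ‖z‖) = (Δ * ‖e‖ - ‖z‖) ^ 2 / Δ := by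
        field_simp; ring
      have h6 : 0 ≤ (Δ * ‖e‖ - ‖z‖) ^ 2 / Δ := by positivity
      linarith
    linarith
  have y2 := mul_le_mul_of_nonneg_left young hs0.le
  -- With `s S = 1 / 512` the second-order terms become `8 / 512 = 1 / 64` of the energy at `e` and
  -- `16 / 512 = 1 / 32` of that at `e0`. The first leaves the `63 / 64` of the statement.
  have b2 := mul_le_mul_of_nonneg_left bU (sq_nonneg s)
  have e1 : s ^ 2 * (4 * (2 * S * energy D lam e + 2 * S * energy D lam e0 +
      2 * S * energy D lam e0 + ‖z‖ ^ 2)) = s * (s * S) * (8 * energy D lam e +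
      16 * energy D lam e0) + s * (4 * s * ‖z‖ ^ 2) := by ring
  rw [e1, hsS] at b2
  have h4s : 4 * s * ‖z‖ ^ 2 ≤ ‖z‖ ^ 2 / Δ := by
    rw [le_div_iff₀ hΔ]
    have : s * Δ ≤ 1 / 512 := by rw [← hsS]; gcongr
    nlinarith [sq_nonneg ‖z‖]
  have h4s' := mul_le_mul_of_nonneg_left h4s hs0.le
  have e2 : s * (energy D lam e0 / 32 + 2 * ‖z‖ ^ 2 / Δ) =
    s * energy D lam e0 / 32 + 2 * (s * (‖z‖ ^ 2 / Δ)) := by ring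
  rw [e2]
  linarith

end Solver

/-! ### One streaming SVRG step. -/

section Iteration

open scoped ENNReal

variable {d : ℕ}

theorem gradPsi_eq (lam : ℝ) (b a y : Vec d) :
    gradPsi lam b a y = tick (6 * d) (shiftOuter lam a y - b) := by
  funext ω c
  simp only [gradPsi, dotV, scaleV, subV, bind_apply, tick, shiftOuter]
  congr 2
  ring

/-- The update of streaming SVRG at the anchor `y0`. -/
noncomputable def svrgUpdate (lam s : ℝ) (b y0 g a y : Vec d) : Vec d :=
  y - s • (shiftOuter lam a y - b - (shiftOuter lam a y0 - b) + g)

@[fun_prop]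
theorem measurable_svrgUpdate {γ : Type*} [MeasurableSpace γ] (lam s : ℝ)
    {f1 f2 f3 f4 f5 : γ → Vec d} (h1 : Measurable f1) (h2 : Measurable f2) (h3 : Measurable f3)
    (h4 : Measurable f4) (h5 : Measurable f5) :
    Measurable fun x => svrgUpdate lam s (f1 x) (f2 x) (f3 x) (f4 x) (f5 x) := by
  unfold svrgUpdate; fun_prop

/-- Merging the elementary operations into one charge per sample puts both loops in the form
`sampleStep`, for expectations and for costs alike. -/
theorem ssvrgIter_eq (lam : ℝ) (b : Vec d) (p : SvrgParams) (y0 : Vec d) :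
    ssvrgIter lam b p y0 = (tick d 0 >>= fun z =>
      loop p.k (sampleStep (7 * d) fun a s => s + (shiftOuter lam a y0 - b)) z >>= fun s =>
      tick 1 (1 / (p.k : ℝ)) >>= fun w => tick d (w • s) >>= fun g =>
      uniformUpTo p.m >>= fun n =>
      loop n (sampleStep (16 * d) (svrgUpdate lam p.stepSize b y0 g)) y0) := by
  have h1 : (fun s : Vec d => (do
      let a ← nextSample
      let h ← gradPsi lam b a y0
      addV s h : Alg d (Vec d))) =
      sampleStep (7 * d) fun a s => s + (shiftOuter lam a y0 - b) := by
    funext s ω c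
    simp only [gradPsi_eq, sampleStep, addV, bind_apply, tick]
    congr 2
    ring
  have h2 : ∀ g : Vec d, (fun y : Vec d => (do
      let a ← nextSample
      let h ← gradPsi lam b a y
      let h0 ← gradPsi lam b a y0
      let u ← subV h h0
      let v ← addV u g
      let e ← scaleV p.stepSize v
      subV y e : Alg d (Vec d))) =
      sampleStep (16 * d) (svrgUpdate lam p.stepSize b y0 g) := by
    intro g
    funext y ω c
    simp only [gradPsi_eq, sampleStep, addV, subV, scaleV, bind_apply, tick, svrgUpdate]
    congr 2
    ring
  simp only [ssvrgIter, h1, h2]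
  rfl

variable {D : Measure (Vec d)} [IsProbabilityMeasure D]

theorem Streaming.svrgTail (lam : ℝ) (p : SvrgParams) :
    Streaming D fun q : (Vec d × Vec d) × Vec d =>
      OnlinePCA.uniformUpTo p.m >>= fun n =>
      OnlinePCA.loop n (OnlinePCA.sampleStep (16 * d)
        (svrgUpdate lam p.stepSize q.1.1 q.1.2 q.2)) q.1.2 := by
  refine Streaming.bind (Streaming.uniformUpTo p.m) ?_
  refine Streaming.loop_nat (f := fun q : ((Vec d × Vec d) × Vec d) × ℕ =>
    OnlinePCA.sampleStep (16 * d) (svrgUpdate lam p.stepSize q.1.1.1 q.1.1.2 q.1.2)) ?_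
    (by fun_prop) (by fun_prop)
  exact Streaming.sampleStep _ (step := fun q : ((Vec d × Vec d) × Vec d) × ℕ =>
    svrgUpdate lam p.stepSize q.1.1.1 q.1.1.2 q.1.2) (by fun_prop)

theorem Streaming.svrgMean (lam : ℝ) (p : SvrgParams) :
    Streaming D fun q : (Vec d × Vec d) × Vec d =>
      OnlinePCA.loop p.k (OnlinePCA.sampleStep (7 * d)
        fun a s => s + (shiftOuter lam a q.1.2 - q.1.1)) q.2 := by
  refine Streaming.loop (f := fun q : (Vec d × Vec d) × Vec d =>
    OnlinePCA.sampleStep (7 * d) fun a s => s + (shiftOuter lam a q.1.2 - q.1.1)) ?_ _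
    (by fun_prop)
  exact Streaming.sampleStep _ (step := fun (q : (Vec d × Vec d) × Vec d) a s =>
    s + (shiftOuter lam a q.1.2 - q.1.1)) (by fun_prop)

theorem Streaming.ssvrgIter (lam : ℝ) (p : SvrgParams) :
    Streaming D fun q : Vec d × Vec d => OnlinePCA.ssvrgIter lam q.1 p q.2 := by
  simp only [ssvrgIter_eq]
  refine Streaming.bind (Streaming.tick d measurable_const) (Streaming.bind
    (Streaming.svrgMean lam p) (Streaming.bind (Streaming.tick 1 measurable_const)
    (Streaming.bind (Streaming.tick d ?_) ?_)))
  · fun_prop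
  · exact (Streaming.svrgTail lam p).comp
      (h := fun q : ((((Vec d × Vec d) × Vec d) × Vec d) × ℝ) × Vec d => (q.1.1.1.1, q.2))
      (by fun_prop)

@[fun_prop]
theorem measurable_energy {γ : Type*} [MeasurableSpace γ] (D : Measure (Vec d)) (lam : ℝ)
    {f : γ → Vec d} (hf : Measurable f) : Measurable fun x => energy D lam (f x) := by
  unfold energy; fun_prop

variable {α γ : Type} [MeasurableSpace α] [MeasurableSpace γ]

theorem expect_tick_bind (n : ℕ) (x : α) {f : α → Alg d γ} (hf : Streaming D f) {F : γ → ℝ≥0∞}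
    (hF : Measurable F) : expect D (tick n x >>= f) F = expect D (f x) F := by
  rw [expect_bind (Streaming.tick (D := D) (β := Unit) (h := fun _ => x) n measurable_const)
    hf hF, expect_tick]

variable {lam Δ v : ℝ}

/-- Telescoping `‖y - xs‖²` along the inner loop bounds the sum of the expected energies of the
iterates. The uniformly random stopping index turns this sum into an average. -/
theorem SolverHyp.expect_svrgTail_le (H : SolverHyp D lam Δ v) {p : SvrgParams}
    (hs : p.stepSize = 1 / (512 * (v * lam ^ 2 / Δ)))
    (hm : 8192 * (v * lam ^ 2 / Δ ^ 2) ≤ p.m) {b xs : Vec d} (hxs : lam • xs - Sigma D xs = b)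
    (y0 g : Vec d) :
    expect D (uniformUpTo p.m >>= fun n =>
        loop n (sampleStep (16 * d) (svrgUpdate lam p.stepSize b y0 g)) y0)
      (fun y => ENNReal.ofReal (energy D lam (y - xs))) ≤
    ENNReal.ofReal (64 / 63 * (energy D lam (y0 - xs) / 8)) +
      ENNReal.ofReal (64 / 63 * (4 / Δ)) *
        ENNReal.ofReal (‖g - (lam • y0 - Sigma D y0 - b)‖ ^ 2) := by
  have hΔ := H.pos
  have hlam : 0 < lam := H.pos.trans_le H.le
  have hm0 : (0 : ℝ) < p.m := by exact_mod_cast p.m_pos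
  have hm1 : (1 : ℝ) ≤ p.m := by exact_mod_cast p.m_pos
  have hs0 := p.stepSize_pos
  set s := p.stepSize with hs'
  set z := g - (lam • y0 - Sigma D y0 - b) with hz
  set W0 := energy D lam (y0 - xs) with hW0
  have hW0' : 0 ≤ W0 := H.energy_nonneg _
  have hst : Measurable fun q : Vec d × Vec d => svrgUpdate lam s b y0 g q.1 q.2 := by fun_prop
  have hF : Measurable fun y : Vec d => ENNReal.ofReal (energy D lam (y - xs)) := by fun_prop
  -- The right-hand side `b` cancels, so the error `y - xs` obeys the recursion of
  -- `SolverHyp.update_le`, with `z` the error of the averaged gradient.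
  have hstep : ∀ a y, svrgUpdate lam s b y0 g a y - xs = (y - xs) - s •
      (shiftOuter lam a (y - xs) - shiftOuter lam a (y0 - xs) +
        (lam • (y0 - xs) - Sigma D (y0 - xs) + z)) := by
    intro a y
    have hg : lam • (y0 - xs) - Sigma D (y0 - xs) + z = g := by
      rw [hz, ← hxs, map_sub, smul_sub]; abel
    rw [hg, svrgUpdate, shiftOuter_sub, shiftOuter_sub, sub_sub_sub_cancel_right,
      sub_sub_sub_cancel_right]
    abel
  set R := s * (W0 / 32 + 2 * ‖z‖ ^ 2 / Δ) with hR
  have hR0 : 0 ≤ R := by positivity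
  -- With `p.m + 1` updates the sum covers the indices `0, …, m`. Dropping index `0` leaves the
  -- iterates `1, …, m`, which are those that the draw can return.
  have tel := sum_expect_loop_le (D := D) (16 * d) hst
    (V := fun y => ENNReal.ofReal (‖y - xs‖ ^ 2))
    (W := fun y => ENNReal.ofReal (s * (63 / 64) * energy D lam (y - xs)))
    (R := ENNReal.ofReal R) (by fun_prop) (by fun_prop)
    (fun y => by simpa only [hstep] using H.update_le hs (y - xs) (y0 - xs) z) (p.m + 1) y0
  have e1 : ∀ j, expect D (loop j (sampleStep (16 * d) (svrgUpdate lam s b y0 g)) y0)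
      (fun y => ENNReal.ofReal (s * (63 / 64) * energy D lam (y - xs))) =
      ENNReal.ofReal (s * (63 / 64)) *
      expect D (loop j (sampleStep (16 * d) (svrgUpdate lam s b y0 g)) y0)
      (fun y => ENNReal.ofReal (energy D lam (y - xs))) := by
    intro j
    rw [← expect_const_mul ((Streaming.loop_sampleStep j (16 * d) hst).comp measurable_const) hF]
    simp only [ENNReal.ofReal_mul (show 0 ≤ s * (63 / 64) by positivity)]
  simp only [e1] at tel
  rw [← Finset.mul_sum, Finset.sum_range_succ'] at tel
  have tel2 := (mul_le_mul_right (le_self_add (a := ∑ j ∈ Finset.range p.m,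
    expect D (loop (j + 1) (sampleStep (16 * d) (svrgUpdate lam s b y0 g)) y0)
      (fun y => ENNReal.ofReal (energy D lam (y - xs))))
      (b := expect D (loop 0 (sampleStep (16 * d) (svrgUpdate lam s b y0 g)) y0)
      (fun y => ENNReal.ofReal (energy D lam (y - xs))))) (ENNReal.ofReal (s * (63 / 64)))).trans
    (le_self_add.trans tel)
  have hl : Streaming D fun n =>
      loop n (sampleStep (16 * d) (svrgUpdate lam s b y0 g)) y0 :=
    Streaming.loop_nat (f := fun _ : ℕ => sampleStep (16 * d) (svrgUpdate lam s b y0 g))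
      (Streaming.sampleStep _ (step := fun _ : ℕ => svrgUpdate lam s b y0 g) (by fun_prop))
      measurable_id measurable_const
  rw [expect_bind (Streaming.uniformUpTo p.m) hl hF]
  refine (expect_uniformUpTo_le p.m_pos _).trans ?_
  set T := ∑ j ∈ Finset.range p.m,
    expect D (loop (j + 1) (sampleStep (16 * d) (svrgUpdate lam s b y0 g)) y0)
      (fun y => ENNReal.ofReal (energy D lam (y - xs)))
  have e2 : ENNReal.ofReal (1 / (p.m : ℝ)) * T = ENNReal.ofReal (64 / (63 * s * p.m)) *
      (ENNReal.ofReal (s * (63 / 64)) * T) := by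
    rw [← mul_assoc, ← ENNReal.ofReal_mul (by positivity)]
    congr 2
    field_simp
  rw [e2]
  refine (mul_le_mul_right tel2 _).trans ?_
  rw [show ((p.m + 1 : ℕ) : ℝ≥0∞) = ENNReal.ofReal ((p.m : ℝ) + 1) by
      rw [← Nat.cast_succ, ENNReal.ofReal_natCast],
    ← ENNReal.ofReal_mul (by positivity), ← ENNReal.ofReal_add (by positivity) (by positivity),
    ← ENNReal.ofReal_mul (by positivity), ← ENNReal.ofReal_mul (by positivity),
    ← ENNReal.ofReal_add (by positivity) (by positivity)]
  refine ENNReal.ofReal_le_ofReal ?_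
  have h1 : ‖y0 - xs‖ ^ 2 ≤ W0 / Δ := by
    rw [le_div_iff₀ hΔ, mul_comm]; exact H.coercive _
  -- The choice of `s` and `m` gives `Δ s m ≥ 8192 / 512 = 16`. The initial distance and the anchor
  -- energy then contribute `W0 / 16` each, the latter because `m + 1 ≤ 2 m`.
  have h2 : 1 / (Δ * (s * p.m)) ≤ 1 / 16 := by
    refine one_div_le_one_div_of_le (by norm_num) ?_
    have : 16 = Δ * (s * (8192 * (v * lam ^ 2 / Δ ^ 2))) := by
      rw [hs]
      have hv : 0 < v := zero_lt_one.trans_le H.one_le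
      field_simp
      norm_num
    rw [this]
    gcongr
  calc 64 / (63 * s * p.m) * (‖y0 - xs‖ ^ 2 + (p.m + 1) * R)
      ≤ 64 / (63 * s * p.m) * (W0 / Δ + (2 * p.m) * R) := by
        gcongr
        linarith
    _ = 64 / 63 * (W0 * (1 / (Δ * (s * p.m))) + W0 / 16 + 4 * ‖z‖ ^ 2 / Δ) := by
        rw [hR]; field_simp; ring
    _ ≤ 64 / 63 * (W0 * (1 / 16) + W0 / 16 + 4 * ‖z‖ ^ 2 / Δ) := by gcongr
    _ = _ := by ring

/-- The noise of the averaged gradient is of order `v lam² ‖y0‖² / k`. It does not vanish at the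
solution, as `‖y0‖²` is bounded through the energies of both `y0 - xs` and `xs`; hence the additive
term, which `ρ` tunes through `k`. -/
theorem SolverHyp.expect_ssvrgIter_le (H : SolverHyp D lam Δ v) {p : SvrgParams}
    (hs : p.stepSize = 1 / (512 * (v * lam ^ 2 / Δ)))
    (hm : 8192 * (v * lam ^ 2 / Δ ^ 2) ≤ p.m) {ρ : ℝ} (hρ0 : 0 ≤ ρ) (hρ1 : ρ ≤ 1)
    (hk : 128 * (v * lam ^ 2 / Δ ^ 2) ≤ ρ * p.k)
    {b xs : Vec d} (hxs : lam • xs - Sigma D xs = b) (y0 : Vec d) :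
    expect D (ssvrgIter lam b p y0) (fun y => ENNReal.ofReal (energy D lam (y - xs))) ≤
      ENNReal.ofReal (energy D lam (y0 - xs) / 4 + ρ * energy D lam xs / 4) := by
  have hΔ := H.pos
  have hk0 : (0 : ℝ) < p.k := by exact_mod_cast p.k_pos
  have hF : Measurable fun y : Vec d => ENNReal.ofReal (energy D lam (y - xs)) := by fun_prop
  set W0 := energy D lam (y0 - xs) with hW0
  have hW0' : 0 ≤ W0 := H.energy_nonneg _
  have hX0 : 0 ≤ energy D lam xs := H.energy_nonneg _
  have hst : Measurable fun q : Vec d × Vec d => q.2 + (shiftOuter lam q.1 y0 - b) := by fun_prop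
  have htail : Streaming D fun g : Vec d => uniformUpTo p.m >>= fun n =>
      loop n (sampleStep (16 * d) (svrgUpdate lam p.stepSize b y0 g)) y0 :=
    (Streaming.svrgTail lam p).comp (h := fun g : Vec d => ((b, y0), g)) (by fun_prop)
  have h2 : ∀ s : Vec d, Streaming D fun w : ℝ => tick d (w • s) >>= fun g =>
      uniformUpTo p.m >>= fun n =>
      loop n (sampleStep (16 * d) (svrgUpdate lam p.stepSize b y0 g)) y0 := fun s =>
    Streaming.bind (Streaming.tick d (by fun_prop)) (htail.comp measurable_snd)
  have h3 : Streaming D fun s : Vec d => tick 1 (1 / (p.k : ℝ)) >>= fun w =>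
      tick d (w • s) >>= fun g => uniformUpTo p.m >>= fun n =>
      loop n (sampleStep (16 * d) (svrgUpdate lam p.stepSize b y0 g)) y0 :=
    Streaming.bind (Streaming.tick 1 measurable_const) (Streaming.bind
      (Streaming.tick d (by fun_prop)) (htail.comp measurable_snd))
  have hloop := Streaming.loop_sampleStep (D := D)
    (step := fun a s => s + (shiftOuter lam a y0 - b)) p.k (7 * d) hst
  rw [ssvrgIter_eq, expect_tick_bind _ _ (Streaming.bind hloop (h3.comp measurable_snd)) hF,
    expect_bind (hloop.comp measurable_const) h3 hF]
  simp only [expect_tick_bind _ _ (h2 _) hF, expect_tick_bind _ _ htail hF]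
  refine (expect_mono fun s => H.expect_svrgTail_le hs hm hxs y0 _).trans ?_
  set μ := lam • y0 - Sigma D y0 - b with hμ
  have lp : MemLp (fun a => shiftOuter lam a y0 - b) 2 D :=
    (memLp_shiftOuter H.moment y0).sub (memLp_const b)
  have imu : ∫ a, (shiftOuter lam a y0 - b) ∂D = μ := by
    rw [integral_sub ((memLp_shiftOuter H.moment y0).integrable (by norm_num))
      (integrable_const _), integral_shiftOuter H.moment]
    simp [hμ]
  -- Only the part `⟪a, y0⟫ • a` of the gradient is random.
  have hvar : ∫ a, ‖shiftOuter lam a y0 - b - ∫ a, (shiftOuter lam a y0 - b) ∂D‖ ^ 2 ∂D ≤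
      v * lam ^ 2 * ‖y0‖ ^ 2 := by
    refine le_trans (le_of_eq ?_) (((norm_integral_sq_le (memLp_outer H.moment y0)).2).trans
      (H.fourth y0))
    refine integral_congr_ae (Filter.Eventually.of_forall fun a => ?_)
    simp only [imu]
    rw [← Sigma_eq_integral H.moment, hμ, shiftOuter, ← norm_neg]
    congr 2
    abel
  have hmean := expect_loop_mean_le (D := D) (7 * d) (h := fun a => shiftOuter lam a y0 - b)
    (by fun_prop) lp p.k_pos
  rw [imu] at hmean hvar
  simp only [← hW0, add_comm (ENNReal.ofReal (64 / 63 * (W0 / 8)))]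
  rw [expect_add_const, expect_const_mul (hloop.comp measurable_const) (by fun_prop)]
  refine (add_le_add_left (mul_le_mul_right hmean _) _).trans ?_
  rw [← ENNReal.ofReal_mul (by positivity), ← ENNReal.ofReal_add (by positivity) (by positivity)]
  refine ENNReal.ofReal_le_ofReal ?_
  have hy0 : ‖y0‖ ^ 2 ≤ 2 * (W0 + energy D lam xs) / Δ := by
    rw [le_div_iff₀ hΔ]
    have h1 := H.coercive (y0 - xs)
    have h2 := H.coercive xs
    have h3 : ‖y0‖ ≤ ‖y0 - xs‖ + ‖xs‖ := by simpa using norm_add_le (y0 - xs) xs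
    have h4 : ‖y0‖ ^ 2 ≤ 2 * (‖y0 - xs‖ ^ 2 + ‖xs‖ ^ 2) := by
      nlinarith [norm_nonneg y0, sq_nonneg (‖y0 - xs‖ - ‖xs‖)]
    nlinarith
  have hq : v * lam ^ 2 / Δ ^ 2 ≤ ρ * p.k / 128 := by linarith
  have hvl : 0 ≤ v * lam ^ 2 := mul_nonneg (zero_le_one.trans H.one_le) (sq_nonneg _)
  have e3 : 4 / Δ * ((∫ a, ‖shiftOuter lam a y0 - b - μ‖ ^ 2 ∂D) / p.k) ≤
      ρ * (W0 + energy D lam xs) / 16 := by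
    calc 4 / Δ * ((∫ a, ‖shiftOuter lam a y0 - b - μ‖ ^ 2 ∂D) / p.k)
        ≤ 4 / Δ * ((v * lam ^ 2 * (2 * (W0 + energy D lam xs) / Δ)) / p.k) := by
          gcongr
          exact hvar.trans (mul_le_mul_of_nonneg_left hy0 hvl)
      _ = v * lam ^ 2 / Δ ^ 2 * (8 * (W0 + energy D lam xs) / p.k) := by
          field_simp; ring
      _ ≤ ρ * p.k / 128 * (8 * (W0 + energy D lam xs) / p.k) := by gcongr
      _ = _ := by field_simp; ring
  have h5 : ρ * W0 ≤ 1 * W0 := by gcongr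
  have h6 : 0 ≤ ρ * energy D lam xs := by positivity
  rw [mul_assoc]
  nlinarith

end Iteration

/-! ### The linear system solver, the Rayleigh estimate, and one round. -/

section Round

open scoped ENNReal

variable {d : ℕ}

theorem pure_apply {α : Type} (x : α) (ω : Tape d) (c : Counters) :
    (pure x : Alg d α) ω c = (x, c) := rfl

theorem measurableSet_le_and_le {γ : Type*} [MeasurableSpace γ] {f g : γ → ℝ} (hf : Measurable f)
    (hg : Measurable g) (s t : ℝ) : MeasurableSet {x | s ≤ f x ∧ t ≤ g x} :=
  MeasurableSet.inter (s₁ := {x | s ≤ f x}) (s₂ := {x | t ≤ g x})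
    (measurableSet_le measurable_const hf) (measurableSet_le measurable_const hg)

theorem loopList_append {α δ : Type} (ps qs : List δ) (f : δ → α → Alg d α) (s : α) :
    loopList (ps ++ qs) f s = loopList ps f s >>= fun y => loopList qs f y := by
  induction ps generalizing s with
  | nil => rfl
  | cons p ps ih =>
    funext ω c
    simp only [List.cons_append, loopList, bind_apply, ih]

theorem batchMean_eq (k : ℕ) (u : Vec d) :
    batchMean k u = loop k (sampleStep (2 * d + 2) fun a s => s + inner ℝ a u ^ 2) 0 >>=
      fun s : ℝ => tick 1 (s / k) := rfl

/-- The schedule uses a single batch, whose median is its mean. The constant `4` is one operation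
for the list, one for the loop and two for the median. -/
theorem rayQuot_one (k : ℕ) (u : Vec d) :
    rayQuot k 1 u = batchMean k u >>= fun r => tick 4 r := by
  funext ω c
  simp [rayQuot, loop, bind_apply, medianA, medianOf, tick, pure_apply]

theorem normalize_eq (x : Vec d) :
    normalize x = tick (3 * d + 2) ((1 / ‖x‖) • x, ‖x‖) := by
  funext ω c
  simp only [normalize, normA, dotV, scaleV, bind_apply, tick, pure_apply, norm_eq_sqrt_real_inner]
  congr 2
  ring

variable {D : Measure (Vec d)} [IsProbabilityMeasure D] {α δ : Type} [MeasurableSpace α]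

theorem expect_loopList_concat (ps : List δ) (p : δ) {f : δ → α → Alg d α}
    (hf : ∀ p, Streaming D (f p)) (s : α) {F : α → ℝ≥0∞} (hF : Measurable F) :
    expect D (loopList (ps ++ [p]) f s) F =
      expect D (loopList ps f s) fun y => expect D (f p y) F := by
  have hf' : ∀ p, Streaming D fun q : α × α => f p q.2 := fun p => (hf p).comp measurable_snd
  have hl : ∀ ps : List δ, Streaming D fun y => loopList ps f y := fun ps =>
    Streaming.loopList ps (f := fun _ : α => f) hf' measurable_id
  rw [loopList_append, expect_bind ((hl ps).comp measurable_const) (hl [p]) hF]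
  rfl

/-- The parameters of the `j`-th SVRG step of a solve. -/
noncomputable def svrgParam {S Δ : ℝ} (hS : 0 < S) (hΔ : 0 < Δ) (j : ℕ) : SvrgParams where
  stepSize := 1 / (512 * S)
  -- Step `j` aims at noise level `ρ = 2⁻ʲ`, so `k` doubles from step to step while `m` stays fixed.
  k := ⌈128 * 2 ^ j * (S / Δ)⌉₊
  m := ⌈8192 * (S / Δ)⌉₊
  stepSize_pos := by positivity
  k_pos := Nat.ceil_pos.mpr (by positivity)
  m_pos := Nat.ceil_pos.mpr (by positivity)

theorem Streaming.solve (lam : ℝ) (ps : List SvrgParams) :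
    Streaming D fun b : Vec d => OnlinePCA.solve lam ps b := by
  refine Streaming.bind (Streaming.tick d measurable_const) ?_
  refine Streaming.loopList ps (f := fun (q : Vec d × Vec d) p y =>
    OnlinePCA.ssvrgIter lam q.1 p y) (fun p => ?_) measurable_snd
  exact (Streaming.ssvrgIter lam p).comp
    (h := fun q : (Vec d × Vec d) × Vec d => (q.1.1, q.2)) (by fun_prop)

variable {lam Δ v : ℝ}

/-- Step `n` with noise level `2⁻ⁿ` leaves `2⁻ⁿ / 4` from the previous error and `2⁻ⁿ / 4` of new
noise, which add up to `2⁻ⁿ⁻¹` times the energy of `xs`. -/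
theorem SolverHyp.expect_solve_le (H : SolverHyp D lam Δ v) {S : ℝ} (hS : 0 < S)
    (hSv : S = v * lam ^ 2 / Δ) {b xs : Vec d} (hxs : lam • xs - Sigma D xs = b) (n : ℕ) :
    expect D (solve lam ((List.range n).map (svrgParam hS H.pos)) b)
        (fun y => ENNReal.ofReal (energy D lam (y - xs))) ≤
      ENNReal.ofReal ((1 / 2) ^ n * energy D lam xs) := by
  have hX := H.energy_nonneg xs
  have hF : Measurable fun y : Vec d => ENNReal.ofReal (energy D lam (y - xs)) := by fun_prop
  have hf : ∀ p, Streaming D fun y => ssvrgIter lam b p y := fun p =>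
    (Streaming.ssvrgIter lam p).comp (h := fun y : Vec d => (b, y)) (by fun_prop)
  have hf' : ∀ p, Streaming D fun q : Vec d × Vec d => ssvrgIter lam b p q.2 :=
    fun p => (hf p).comp measurable_snd
  have hl : ∀ ps, Streaming D fun y => loopList ps (fun p y => ssvrgIter lam b p y) y := fun ps =>
    Streaming.loopList ps (f := fun _ : Vec d => fun p y => ssvrgIter lam b p y) hf' measurable_id
  have hq : v * lam ^ 2 / Δ ^ 2 = S / Δ := by rw [hSv]; field_simp
  change expect D (tick d 0 >>= fun z => loopList _ (fun p y => ssvrgIter lam b p y) z) _ ≤ _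
  rw [expect_tick_bind _ _ (hl _) hF]
  induction n with
  | zero =>
    simp only [List.range_zero, List.map_nil, loopList, expect_pure, pow_zero, one_mul, zero_sub]
    refine ENNReal.ofReal_le_ofReal (le_of_eq ?_)
    rw [energy, energy, smul_neg, map_neg, sub_neg_eq_add, neg_add_eq_sub, ← neg_sub,
      inner_neg_neg]
  | succ n ih =>
    rw [List.range_succ, List.map_append, List.map_singleton, expect_loopList_concat _ _ hf _ hF]
    refine (expect_mono fun y => H.expect_ssvrgIter_le (ρ := (1 / 2) ^ n) ?_ ?_ (by positivity)
      (pow_le_one₀ (by norm_num) (by norm_num)) ?_ hxs y).trans ?_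
    · rw [← hSv]; rfl
    · rw [hq]; exact Nat.le_ceil _
    · rw [hq]
      have h1 : 128 * 2 ^ n * (S / Δ) ≤ ((svrgParam hS H.pos n).k : ℝ) := Nat.le_ceil _
      calc 128 * (S / Δ) = (1 / 2) ^ n * (128 * 2 ^ n * (S / Δ)) := by
            rw [one_div, inv_pow]; field_simp
        _ ≤ _ := by gcongr
    · have e : ∀ y, ENNReal.ofReal (energy D lam (y - xs) / 4 + (1 / 2) ^ n * energy D lam xs / 4) =
          ENNReal.ofReal (1 / 4) * ENNReal.ofReal (energy D lam (y - xs)) +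
            ENNReal.ofReal ((1 / 2) ^ n * energy D lam xs / 4) := by
        intro y
        have := H.energy_nonneg (y - xs)
        rw [← ENNReal.ofReal_mul (by norm_num), ← ENNReal.ofReal_add (by positivity)
          (by positivity)]
        congr 1; ring
      simp only [e]
      rw [expect_add_const, expect_const_mul ((hl _).comp measurable_const) hF]
      refine (add_le_add_left (mul_le_mul_right ih _) _).trans ?_
      rw [← ENNReal.ofReal_mul (by norm_num), ← ENNReal.ofReal_add (by positivity) (by positivity)]
      refine ENNReal.ofReal_le_ofReal (le_of_eq ?_)
      ring

theorem Streaming.batchMean (k : ℕ) : Streaming D fun u : Vec d => OnlinePCA.batchMean k u := by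
  simp only [batchMean_eq]
  refine Streaming.bind ?_ (Streaming.tick 1 (by fun_prop))
  refine Streaming.loop (f := fun u : Vec d => OnlinePCA.sampleStep (2 * d + 2)
    fun a (s : ℝ) => s + inner ℝ a u ^ 2) ?_ k measurable_const
  exact Streaming.sampleStep _ (step := fun (u : Vec d) a (s : ℝ) => s + inner ℝ a u ^ 2)
    (by fun_prop)

theorem SolverHyp.expect_batchMean_le (H : SolverHyp D lam Δ v) {k : ℕ} (hk : 0 < k) {u : Vec d}
    (hu : ‖u‖ = 1) :
    expect D (batchMean k u) (fun r => ENNReal.ofReal ((r - inner ℝ u (Sigma D u)) ^ 2)) ≤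
      ENNReal.ofReal (v * lam ^ 2 / k) := by
  obtain ⟨hL, hpt⟩ := memLp_inner_sq H.moment hu
  have hst : Measurable fun q : Vec d × ℝ => q.2 + inner ℝ q.1 u ^ 2 := by fun_prop
  have hloop := Streaming.loop_sampleStep (D := D) (step := fun (a : Vec d) s => s + inner ℝ a u ^ 2)
    k (2 * d + 2) hst
  have hF : Measurable fun r => ENNReal.ofReal ((r - inner ℝ u (Sigma D u)) ^ 2) := by fun_prop
  have hmean := expect_loop_mean_le (D := D) (2 * d + 2)
    (h := fun a : Vec d => (inner ℝ a u ^ 2 : ℝ)) (by fun_prop) hL hk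
  have hvar := ((norm_integral_sq_le hL).2.trans hpt).trans (H.fourth u)
  rw [hu] at hvar
  rw [batchMean_eq, expect_bind (hloop.comp measurable_const)
    (Streaming.tick 1 (by fun_prop)) hF]
  simp only [expect_tick, inner_Sigma H.moment]
  simp only [Real.norm_eq_abs, sq_abs, smul_eq_mul, one_div_mul_eq_div] at hmean hvar
  refine hmean.trans (ENNReal.ofReal_le_ofReal ?_)
  gcongr
  linarith

theorem powerRound_eq (lam lamHat : ℝ) {p : RoundParams} (hp : p.batches = 1) (x : Vec d) :
    powerRound lam lamHat p x = solve lam p.svrg x >>= fun xh =>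
      tick (3 * d + 2) ((1 / ‖xh‖) • xh, ‖xh‖) >>= fun u =>
      batchMean p.batchSize u.1 >>= fun r => tick 12
        (if lamHat - (lam - lamHat) / 6 ≤ r ∧ (2 / 3) / (lam - lamHat) ≤ u.2 then u.1 else x) := by
  funext ω c
  simp only [powerRound, normalize_eq, hp, rayQuot_one, bind_apply, tick]
  rfl

theorem Streaming.roundTail (lam lamHat : ℝ) (k : ℕ) :
    Streaming D fun q : Vec d × Vec d =>
      OnlinePCA.tick (3 * d + 2) ((1 / ‖q.2‖) • q.2, ‖q.2‖) >>= fun u =>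
      OnlinePCA.batchMean k u.1 >>= fun r => OnlinePCA.tick 12
        (if lamHat - (lam - lamHat) / 6 ≤ r ∧ (2 / 3) / (lam - lamHat) ≤ u.2
          then u.1 else q.1) := by
  refine Streaming.bind (Streaming.tick _ (by fun_prop)) (Streaming.bind
    ((Streaming.batchMean k).comp (by fun_prop)) (Streaming.tick _ ?_))
  exact Measurable.ite (measurableSet_le_and_le measurable_snd measurable_fst.snd.snd _ _)
    (by fun_prop) (by fun_prop)

theorem Streaming.powerRound (lam lamHat : ℝ) {p : RoundParams} (hp : p.batches = 1) :
    Streaming D fun x : Vec d => OnlinePCA.powerRound lam lamHat p x := by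
  simp only [powerRound_eq lam lamHat hp]
  exact Streaming.bind (Streaming.solve lam p.svrg) (Streaming.roundTail lam lamHat _)

/-- A round fails only if the solver is inaccurate (Markov) or the estimate of the Rayleigh
quotient is (Chebyshev). -/
theorem SolverHyp.expect_powerRound_le (H : SolverHyp D lam Δ v) {lamHat : ℝ} {p : RoundParams}
    (hp : p.batches = 1) {x xs : Vec d} {e τ t : ℝ} (he : 0 ≤ e) (hτ : 0 < τ) (ht : 0 < t)
    (hsolve : expect D (solve lam p.svrg x) (fun y => ENNReal.ofReal (energy D lam (y - xs))) ≤
      ENNReal.ofReal e)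
    {F : Vec d → ℝ≥0∞} (hF : Measurable F) (hF1 : ∀ y, F y ≤ 1)
    (hgood : ∀ xh, energy D lam (xh - xs) ≤ τ → xh ≠ 0 ∧ ∀ r : ℝ,
      |r - inner ℝ ((1 / ‖xh‖) • xh) (Sigma D ((1 / ‖xh‖) • xh))| ≤ t →
      F (if lamHat - (lam - lamHat) / 6 ≤ r ∧ (2 / 3) / (lam - lamHat) ≤ ‖xh‖
        then (1 / ‖xh‖) • xh else x) = 0) :
    expect D (powerRound lam lamHat p x) F ≤
      ENNReal.ofReal (e / τ + v * lam ^ 2 / p.batchSize / t ^ 2) := by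
  have hv : 0 ≤ v := zero_le_one.trans H.one_le
  have hxm : Measurable fun xh : Vec d => (x, xh) := by fun_prop
  have htail := (Streaming.roundTail (D := D) lam lamHat p.batchSize).comp hxm
  have hsol : Streaming D fun _ : Unit => solve lam p.svrg x :=
    (Streaming.solve lam p.svrg).comp measurable_const
  rw [powerRound_eq lam lamHat hp, expect_bind hsol htail hF]
  have key : ∀ xh, expect D (tick (3 * d + 2) ((1 / ‖xh‖) • xh, ‖xh‖) >>= fun u =>
      batchMean p.batchSize u.1 >>= fun r => tick 12
        (if lamHat - (lam - lamHat) / 6 ≤ r ∧ (2 / 3) / (lam - lamHat) ≤ u.2 then u.1 else x)) F ≤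
      ENNReal.ofReal (1 / τ) * ENNReal.ofReal (energy D lam (xh - xs)) +
        ENNReal.ofReal (v * lam ^ 2 / p.batchSize / t ^ 2) := by
    intro xh
    -- If the solver misses the accuracy `τ`, the Markov term alone is at least `1 ≥ F`. Otherwise
    -- only a Rayleigh error above `t` can make `F` nonzero, and Chebyshev applies.
    by_cases hE : energy D lam (xh - xs) ≤ τ
    · obtain ⟨hxh, hg⟩ := hgood xh hE
      refine le_add_left ?_
      have hu : ‖(1 / ‖xh‖) • xh‖ = 1 := by
        rw [norm_smul, norm_div, norm_one, norm_norm, one_div_mul_cancel (norm_ne_zero_iff.mpr hxh)]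
      have hm1 : Measurable fun q : (Vec d × ℝ) × ℝ =>
          (if lamHat - (lam - lamHat) / 6 ≤ q.2 ∧ (2 / 3) / (lam - lamHat) ≤ q.1.2
            then q.1.1 else x) :=
        Measurable.ite (measurableSet_le_and_le measurable_snd measurable_fst.snd _ _)
          (by fun_prop) (by fun_prop)
      have s1 : Streaming D fun u : Vec d × ℝ => batchMean p.batchSize u.1 >>= fun r => tick 12
          (if lamHat - (lam - lamHat) / 6 ≤ r ∧ (2 / 3) / (lam - lamHat) ≤ u.2
            then u.1 else x) :=
        Streaming.bind ((Streaming.batchMean _).comp measurable_fst) (Streaming.tick 12 hm1)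
      have s2 : Streaming D fun r : ℝ => tick 12
          (if lamHat - (lam - lamHat) / 6 ≤ r ∧ (2 / 3) / (lam - lamHat) ≤ ‖xh‖
            then (1 / ‖xh‖) • xh else x) := Streaming.tick (D := D) 12 (hm1.comp
        (by fun_prop : Measurable fun r : ℝ => (((1 / ‖xh‖) • xh, ‖xh‖), r)))
      rw [expect_tick_bind _ _ s1 hF,
        expect_bind ((Streaming.batchMean _).comp measurable_const) s2 hF]
      simp only [expect_tick]
      have hb := H.expect_batchMean_le p.batchSize_pos hu
      set R := inner ℝ ((1 / ‖xh‖) • xh) (Sigma D ((1 / ‖xh‖) • xh))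
      refine (expect_mono (G := fun r =>
        ENNReal.ofReal (1 / t ^ 2) * ENNReal.ofReal ((r - R) ^ 2)) fun r => ?_).trans ?_
      · by_cases hr : |r - R| ≤ t
        · rw [hg r hr]; exact zero_le
        · refine (hF1 _).trans ?_
          rw [← ENNReal.ofReal_mul (by positivity), one_div_mul_eq_div, ← ENNReal.ofReal_one]
          refine ENNReal.ofReal_le_ofReal ?_
          rw [one_le_div (by positivity), ← sq_abs (r - R)]
          gcongr
          exact (not_le.mp hr).le
      · rw [expect_const_mul ((Streaming.batchMean _).comp measurable_const) (by fun_prop)]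
        refine (mul_le_mul_right hb _).trans ?_
        rw [← ENNReal.ofReal_mul (by positivity), one_div_mul_eq_div]
    · refine ((expect_mono hF1).trans (expect_const_le _ 1)).trans (le_add_right ?_)
      rw [← ENNReal.ofReal_mul (by positivity), one_div_mul_eq_div, ← ENNReal.ofReal_one]
      refine ENNReal.ofReal_le_ofReal ?_
      rw [one_le_div hτ]
      exact (not_le.mp hE).le
  refine (expect_mono key).trans ?_
  rw [expect_add_const, expect_const_mul hsol (by fun_prop)]
  refine (add_le_add_left (mul_le_mul_right hsolve _) _).trans ?_
  rw [← ENNReal.ofReal_mul (by positivity), ← ENNReal.ofReal_add (by positivity) (by positivity),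
    one_div_mul_eq_div]

end Round

/-! ### Eigenvalue bounds for `Σ` and consequences of the gap. -/

section SpectralFacts

variable {d : ℕ}

theorem inner_Sigma_left (D : Measure (Vec d)) (x y : Vec d) :
    inner ℝ (Sigma D x) y = inner ℝ x (Sigma D y) := Sigma_isSymmetric D x y

/-- An orthonormal basis of eigenvectors of `Σ`. -/
noncomputable def eigBasis (D : Measure (Vec d)) : OrthonormalBasis (Fin d) ℝ (Vec d) :=
  (Sigma_isSymmetric D).eigenvectorBasis finrank_euclideanSpace_fin

theorem Sigma_eigBasis (D : Measure (Vec d)) (i : Fin d) :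
    Sigma D (eigBasis D i) = eig D i • eigBasis D i :=
  (Sigma_isSymmetric D).apply_eigenvectorBasis finrank_euclideanSpace_fin i

theorem inner_eigBasis_Sigma (D : Measure (Vec d)) (i : Fin d) (w : Vec d) :
    inner ℝ (eigBasis D i) (Sigma D w) = eig D i * inner ℝ (eigBasis D i) w := by
  rw [← inner_Sigma_left, Sigma_eigBasis, inner_smul_left]
  simp

theorem inner_Sigma_eq_sum (D : Measure (Vec d)) (w : Vec d) :
    inner ℝ w (Sigma D w) = ∑ i, eig D i * inner ℝ (eigBasis D i) w ^ 2 := by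
  rw [← (eigBasis D).sum_inner_mul_inner w (Sigma D w)]
  refine Finset.sum_congr rfl fun i _ => ?_
  rw [inner_eigBasis_Sigma, real_inner_comm]
  ring

theorem eig_antitone (D : Measure (Vec d)) : Antitone (eig D) :=
  (Sigma_isSymmetric D).eigenvalues_antitone finrank_euclideanSpace_fin

theorem eig_le_lam1 (hd : 2 ≤ d) (D : Measure (Vec d)) (i : Fin d) : eig D i ≤ lam1 hd D :=
  eig_antitone D (Fin.mk_le_of_le_val (Nat.zero_le _))

theorem eig_le_lam2 (hd : 2 ≤ d) (D : Measure (Vec d)) {i : Fin d} (hi : i ≠ ⟨0, by omega⟩) :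
    eig D i ≤ lam2 hd D :=
  eig_antitone D (Fin.mk_le_of_le_val (Nat.one_le_iff_ne_zero.mpr fun h => hi (Fin.ext h)))

theorem inner_Sigma_le (hd : 2 ≤ d) (D : Measure (Vec d)) (w : Vec d) :
    inner ℝ w (Sigma D w) ≤ lam1 hd D * ‖w‖ ^ 2 := by
  rw [inner_Sigma_eq_sum, ← (eigBasis D).sum_sq_inner_right w, Finset.mul_sum]
  exact Finset.sum_le_sum fun i _ => mul_le_mul_of_nonneg_right (eig_le_lam1 hd D i) (sq_nonneg _)

/-- The given `v1` need not belong to the chosen eigenbasis. The strict gap makes it orthogonal to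
every basis vector but the first, so `w` is orthogonal to that first vector. -/
theorem inner_Sigma_le_of_orthogonal (hd : 2 ≤ d) {D : Measure (Vec d)}
    (hlt : lam2 hd D < lam1 hd D) {v1 : Vec d} (hv1 : ‖v1‖ = 1)
    (hS : Sigma D v1 = lam1 hd D • v1) {w : Vec d} (hw : inner ℝ v1 w = 0) :
    inner ℝ w (Sigma D w) ≤ lam2 hd D * ‖w‖ ^ 2 := by
  have h0 : ∀ i : Fin d, i ≠ ⟨0, by omega⟩ → inner ℝ v1 (eigBasis D i) = 0 := by
    intro i hi
    have h1 := inner_eigBasis_Sigma D i v1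
    rw [hS, inner_smul_right] at h1
    have h2 : (lam1 hd D - eig D i) * inner ℝ (eigBasis D i) v1 = 0 := by linarith
    rcases mul_eq_zero.mp h2 with h | h
    · linarith [eig_le_lam2 hd D hi]
    · rw [real_inner_comm]; exact h
  have h1 : ∀ y : Vec d, inner ℝ v1 y =
      inner ℝ v1 (eigBasis D ⟨0, by omega⟩) * inner ℝ (eigBasis D ⟨0, by omega⟩) y := by
    intro y
    rw [← (eigBasis D).sum_inner_mul_inner v1 y, Finset.sum_eq_single ⟨0, by omega⟩]
    · intro i _ hi
      rw [h0 i hi, zero_mul]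
    · simp
  have h2 : inner ℝ (eigBasis D ⟨0, by omega⟩) w = 0 := by
    have h3 := h1 v1
    rw [real_inner_self_eq_norm_sq, hv1] at h3
    have h4 := h1 w
    rw [hw] at h4
    rcases mul_eq_zero.mp h4.symm with h | h
    · rw [h] at h3; norm_num at h3
    · exact h
  rw [inner_Sigma_eq_sum, ← (eigBasis D).sum_sq_inner_right w, Finset.mul_sum]
  refine Finset.sum_le_sum fun i _ => ?_
  by_cases hi : i = ⟨0, by omega⟩
  · rw [hi, h2]; simp
  · exact mul_le_mul_of_nonneg_right (eig_le_lam2 hd D hi) (sq_nonneg _)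

theorem eig_nonneg {D : Measure (Vec d)} [IsProbabilityMeasure D]
    (h4 : Integrable (fun a => ‖a‖ ^ 4) D) (i : Fin d) : 0 ≤ eig D i := by
  have h := inner_Sigma_nonneg h4 (eigBasis D i)
  rw [Sigma_eigBasis, inner_smul_right, real_inner_self_eq_norm_sq, (eigBasis D).norm_eq_one] at h
  simpa using h

theorem norm_Sigma (hd : 2 ≤ d) {D : Measure (Vec d)} [IsProbabilityMeasure D]
    (h4 : Integrable (fun a => ‖a‖ ^ 4) D) : ‖Sigma D‖ = lam1 hd D := by
  have h0 : 0 ≤ lam1 hd D := eig_nonneg h4 _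
  refine le_antisymm (ContinuousLinearMap.opNorm_le_bound _ h0 fun w => ?_) ?_
  · refine le_of_sq_le_sq ?_ (by positivity)
    rw [mul_pow, ← (eigBasis D).sum_sq_inner_right w, ← (eigBasis D).sum_sq_inner_right (Sigma D w),
      Finset.mul_sum]
    refine Finset.sum_le_sum fun i _ => ?_
    rw [inner_eigBasis_Sigma, mul_pow]
    have := eig_nonneg h4 i
    have := eig_le_lam1 hd D i
    gcongr
  · have h := (Sigma D).le_opNorm (eigBasis D ⟨0, by omega⟩)
    rw [Sigma_eigBasis, norm_smul, (eigBasis D).norm_eq_one, mul_one, mul_one] at h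
    exact (le_abs_self _).trans h

theorem lam1_pos (hd : 2 ≤ d) {D : Measure (Vec d)} [IsProbabilityMeasure D]
    (h4 : Integrable (fun a => ‖a‖ ^ 4) D) (hgap : 0 < gap hd D) : 0 < lam1 hd D := by
  rcases (eig_nonneg h4 ⟨0, by omega⟩).lt_or_eq with h | h
  · exact h
  · have h' : lam1 hd D = 0 := h.symm
    -- Division by zero gives gap `0`, so a positive gap excludes `λ₁ = 0`.
    rw [gap, h', div_zero] at hgap
    exact absurd hgap (lt_irrefl _)

theorem norm_fourthMoment (hd : 2 ≤ d) {D : Measure (Vec d)} [IsProbabilityMeasure D]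
    (h4 : Integrable (fun a => ‖a‖ ^ 4) D) (hgap : 0 < gap hd D) :
    ‖Matrix.toEuclideanCLM (n := Fin d) (𝕜 := ℝ) (fourthMoment D)‖ =
      nvar D * lam1 hd D ^ 2 := by
  have := lam1_pos hd h4 hgap
  rw [nvar, norm_Sigma hd h4]
  field_simp

theorem integral_outer_sq_le (hd : 2 ≤ d) {D : Measure (Vec d)} [IsProbabilityMeasure D]
    (h4 : Integrable (fun a => ‖a‖ ^ 4) D) (hgap : 0 < gap hd D) (w : Vec d) :
    ∫ a, ‖(inner ℝ a w • a : Vec d)‖ ^ 2 ∂D ≤ nvar D * lam1 hd D ^ 2 * ‖w‖ ^ 2 := by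
  rw [← norm_fourthMoment hd h4 hgap, ← inner_fourthMoment h4]
  refine (real_inner_le_norm _ _).trans ?_
  have h := (Matrix.toEuclideanCLM (n := Fin d) (𝕜 := ℝ) (fourthMoment D)).le_opNorm w
  nlinarith [norm_nonneg w]

/-- Jensen at a top unit eigenvector `b`: `λ₁² = (E⟪a, b⟫²)² ≤ E⟪a, b⟫⁴ ≤ v λ₁²`. -/
theorem one_le_nvar (hd : 2 ≤ d) {D : Measure (Vec d)} [IsProbabilityMeasure D]
    (h4 : Integrable (fun a => ‖a‖ ^ 4) D) (hgap : 0 < gap hd D) : 1 ≤ nvar D := by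
  have hl := lam1_pos hd h4 hgap
  set b := eigBasis D ⟨0, by omega⟩
  have hb : ‖b‖ = 1 := (eigBasis D).norm_eq_one _
  obtain ⟨hL, h1⟩ := memLp_inner_sq h4 hb
  have h2 := (norm_integral_sq_le hL).1.trans (h1.trans (integral_outer_sq_le hd h4 hgap b))
  rw [← inner_Sigma h4, Sigma_eigBasis, inner_smul_right, real_inner_self_eq_norm_sq, hb] at h2
  simp only [Real.norm_eq_abs, sq_abs, one_pow, mul_one] at h2
  exact le_of_mul_le_mul_right ((one_mul (lam1 hd D ^ 2)).trans_le h2) (by positivity)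

end SpectralFacts

/-! ### Inverse iteration contracts the potential. -/

section Contraction

variable {d : ℕ} {D : Measure (Vec d)} {lam : ℝ}

theorem energy_eq (w : Vec d) :
    energy D lam w = lam * ‖w‖ ^ 2 - inner ℝ w (Sigma D w) := by
  simp [energy, inner_sub_right, inner_smul_right]

theorem energy_smul (t : ℝ) (w : Vec d) : energy D lam (t • w) = t ^ 2 * energy D lam w := by
  rw [energy_eq, energy_eq, map_smul, norm_smul, inner_smul_left, inner_smul_right, mul_pow]
  simp only [Real.norm_eq_abs, sq_abs, conj_trivial]
  ring

theorem energy_add (x y : Vec d) : energy D lam (x + y) =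
    energy D lam x + energy D lam y + 2 * inner ℝ x (lam • y - Sigma D y) := by
  simp only [energy, map_add, smul_add, inner_add_left, inner_sub_right, inner_add_right,
    inner_smul_right]
  rw [real_inner_comm x y, ← inner_Sigma_left D y x, real_inner_comm x (Sigma D y)]
  ring

/-- The component of `x` orthogonal to the unit vector `v1`. -/
noncomputable def perp (v1 x : Vec d) : Vec d := x - inner ℝ v1 x • v1

theorem perp_add (v1 x y : Vec d) : perp v1 (x + y) = perp v1 x + perp v1 y := by
  simp only [perp, inner_add_right, add_smul]; abel

theorem perp_smul (v1 : Vec d) (t : ℝ) (x : Vec d) : perp v1 (t • x) = t • perp v1 x := by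
  simp only [perp, inner_smul_right, smul_sub, mul_smul]

theorem inner_perp {v1 : Vec d} (hv1 : ‖v1‖ = 1) (x : Vec d) : inner ℝ v1 (perp v1 x) = 0 := by
  simp [perp, inner_sub_right, inner_smul_right, hv1]

theorem norm_sq_perp {v1 : Vec d} (hv1 : ‖v1‖ = 1) (x : Vec d) :
    ‖x‖ ^ 2 = inner ℝ v1 x ^ 2 + ‖perp v1 x‖ ^ 2 := by
  simp [perp, norm_sub_sq_real, inner_smul_right, norm_smul, hv1, real_inner_comm v1 x]
  ring

/-- Shifting by `lam` a little above the top eigenvalue `l1`, with unit eigenvector `v1`. -/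
structure ShiftHyp (D : Measure (Vec d)) (lam l1 : ℝ) (v1 : Vec d) : Prop where
  norm_eq : ‖v1‖ = 1
  eigen : Sigma D v1 = l1 • v1
  lt : l1 < lam
  le_perp : ∀ w, inner ℝ v1 w = 0 → 100 * (lam - l1) * ‖w‖ ^ 2 ≤ energy D lam w

variable {l1 : ℝ} {v1 : Vec d}

namespace ShiftHyp

theorem inner_shift (S : ShiftHyp D lam l1 v1) (x : Vec d) :
    inner ℝ v1 (lam • x - Sigma D x) = (lam - l1) * inner ℝ v1 x := by
  rw [inner_sub_right, inner_smul_right, ← inner_Sigma_left, S.eigen, inner_smul_left]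
  simp; ring

/-- As `v1` is an eigenvector of `B`, its line and the complement are `B`-orthogonal. -/
theorem energy_eq_add (S : ShiftHyp D lam l1 v1) (x : Vec d) :
    energy D lam x = inner ℝ v1 x ^ 2 * (lam - l1) + energy D lam (perp v1 x) := by
  have h : x = inner ℝ v1 x • v1 + perp v1 x := by simp [perp]
  have e1 : energy D lam v1 = lam - l1 := by
    rw [energy, S.inner_shift, real_inner_self_eq_norm_sq, S.norm_eq]; simp
  conv_lhs => rw [h]
  rw [energy_add, energy_smul, e1, inner_smul_left, S.inner_shift, inner_perp S.norm_eq]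
  simp

theorem energy_perp_nonneg (S : ShiftHyp D lam l1 v1) (x : Vec d) :
    0 ≤ energy D lam (perp v1 x) :=
  (mul_nonneg (by linarith [S.lt]) (sq_nonneg _)).trans (S.le_perp _ (inner_perp S.norm_eq x))

theorem energy_nonneg (S : ShiftHyp D lam l1 v1) (x : Vec d) : 0 ≤ energy D lam x := by
  rw [S.energy_eq_add]
  exact add_nonneg (mul_nonneg (sq_nonneg _) (by linarith [S.lt])) (S.energy_perp_nonneg x)

/-- Parallelogram law, with the nonnegative energy of `x - y` dropped. -/
theorem energy_add_le (S : ShiftHyp D lam l1 v1) (x y : Vec d) :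
    energy D lam (x + y) ≤ 2 * energy D lam x + 2 * energy D lam y := by
  have h1 := energy_add (D := D) (lam := lam) x y
  have h2 := energy_add (D := D) (lam := lam) x (-1 • y)
  have h3 := S.energy_nonneg (x + -1 • y)
  have h4 := energy_smul (D := D) (lam := lam) (-1) y
  simp only [neg_smul, one_smul, map_neg, smul_neg] at h2 h3 h4
  rw [show -(lam • y) - -(Sigma D y) = -(lam • y - Sigma D y) by abel, inner_neg_right] at h2
  linarith

/-- The inverse iterate of `x` is nearly parallel to `v1`. -/
theorem energy_perp_solution_le (S : ShiftHyp D lam l1 v1) {x xs : Vec d}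
    (hxs : lam • xs - Sigma D xs = x) :
    energy D lam (perp v1 xs) ≤ energy D lam (perp v1 x) / (100 * (lam - l1)) ^ 2 := by
  have hμ : 0 < 100 * (lam - l1) := by linarith [S.lt]
  set z := perp v1 xs with hz
  set w := perp v1 x with hw
  -- Projection off `v1` commutes with `B`, so the complement can be treated by itself.
  have hBz : lam • z - Sigma D z = w := by
    have h1 : inner ℝ v1 x = (lam - l1) * inner ℝ v1 xs := by rw [← hxs, S.inner_shift]
    rw [hw, perp, h1, ← hxs, hz, perp, map_sub, map_smul, S.eigen]
    simp only [smul_sub, sub_smul, mul_smul, smul_comm lam, smul_comm l1]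
    abel
  have h1 : energy D lam z ≤ ‖z‖ * ‖w‖ := by
    rw [energy, hBz]; exact real_inner_le_norm _ _
  have h2 := S.le_perp z (inner_perp S.norm_eq xs)
  have h3 := S.le_perp w (inner_perp S.norm_eq x)
  set c := 100 * (lam - l1)
  have h4 : c * ‖z‖ ≤ ‖w‖ := by
    rcases (norm_nonneg z).eq_or_lt with h | h
    · rw [← h]; simp
    · exact le_of_mul_le_mul_left (by nlinarith) h
  rw [le_div_iff₀ (by positivity)]
  -- Coercivity `c` on the complement is used on `z` and on `w`: `c * energy z ≤ ‖w‖²` and `c ‖w‖² ≤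
  -- energy w`, whence the factor `c²`.
  have h5 : c * energy D lam z ≤ ‖w‖ ^ 2 := by nlinarith [norm_nonneg w]
  nlinarith

/-- `x` is a unit vector whose squared potential is at most `g`. -/
def Aligned (D : Measure (Vec d)) (lam l1 : ℝ) (v1 : Vec d) (g : ℝ) (x : Vec d) : Prop :=
  ‖x‖ = 1 ∧ energy D lam (perp v1 x) ≤ g * (inner ℝ v1 x ^ 2 * (lam - l1))

theorem measurableSet_aligned (g : ℝ) : MeasurableSet {x | Aligned D lam l1 v1 g x} := by
  have h1 : MeasurableSet {x : Vec d | ‖x‖ = 1} := measurableSet_eq_fun (by fun_prop) (by fun_prop)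
  have h2 : MeasurableSet {x : Vec d |
      energy D lam (perp v1 x) ≤ g * (inner ℝ v1 x ^ 2 * (lam - l1))} := by
    unfold perp
    exact measurableSet_le (by fun_prop) (by fun_prop)
  exact h1.inter h2

/-- For a unit vector the Rayleigh quotient is `lam - energy x`, and the splitting gives `energy x ≤
(1 + g) (lam - l1)`. -/
theorem rayleigh_ge (S : ShiftHyp D lam l1 v1) {g : ℝ} (hg : 0 ≤ g) {x : Vec d}
    (hx : Aligned D lam l1 v1 g x) : l1 - g * (lam - l1) ≤ inner ℝ x (Sigma D x) := by
  have h1 := S.energy_eq_add x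
  have h2 := energy_eq (D := D) (lam := lam) x
  have h3 := norm_sq_perp S.norm_eq x
  rw [hx.1] at h2 h3
  have h4 : inner ℝ v1 x ^ 2 * (lam - l1) ≤ 1 * (lam - l1) :=
    mul_le_mul_of_nonneg_right (by nlinarith [sq_nonneg ‖perp v1 x‖]) (by linarith [S.lt])
  nlinarith [hx.2, mul_le_mul_of_nonneg_left h4 hg]

/-- The `B`-norm weighs the complement at least `100` times more, so `‖perp v1 x‖²` is at most `1 /
1000` of the squared component along `v1`. -/
theorem inner_sq_ge (S : ShiftHyp D lam l1 v1) {g : ℝ} (hg : g ≤ 1 / 10) {x : Vec d}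
    (hx : Aligned D lam l1 v1 g x) : 1000 / 1001 ≤ inner ℝ v1 x ^ 2 := by
  have hμ : 0 < lam - l1 := by linarith [S.lt]
  have h1 := (S.le_perp _ (inner_perp S.norm_eq x)).trans hx.2
  have h3 := norm_sq_perp S.norm_eq x
  rw [hx.1] at h3
  have h4 : g * (inner ℝ v1 x ^ 2 * (lam - l1)) ≤ 1 / 10 * (inner ℝ v1 x ^ 2 * (lam - l1)) :=
    mul_le_mul_of_nonneg_right hg (by positivity)
  have h5 : 100 * ‖perp v1 x‖ ^ 2 ≤ 1 / 10 * inner ℝ v1 x ^ 2 :=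
    le_of_mul_le_mul_right (by linarith) hμ
  linarith

theorem inner_solution (S : ShiftHyp D lam l1 v1) {x xs : Vec d}
    (hxs : lam • xs - Sigma D xs = x) : inner ℝ v1 xs = inner ℝ v1 x / (lam - l1) := by
  rw [eq_div_iff (by linarith [S.lt]), mul_comm, ← S.inner_shift, hxs]

theorem energy_perp_solution_le' (S : ShiftHyp D lam l1 v1) {g : ℝ} {x xs : Vec d}
    (hx : Aligned D lam l1 v1 g x) (hxs : lam • xs - Sigma D xs = x) :
    energy D lam (perp v1 xs) ≤ g / 10000 * (inner ℝ v1 x ^ 2 / (lam - l1)) := by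
  have hμ : 0 < lam - l1 := by linarith [S.lt]
  refine (S.energy_perp_solution_le hxs).trans ?_
  rw [div_le_iff₀ (by positivity)]
  refine hx.2.trans (le_of_eq ?_)
  field_simp
  ring

theorem energy_solution_le (S : ShiftHyp D lam l1 v1) {g : ℝ} (hg : g ≤ 1 / 10) {x xs : Vec d}
    (hx : Aligned D lam l1 v1 g x) (hxs : lam • xs - Sigma D xs = x) :
    energy D lam xs ≤ 2 * (inner ℝ v1 x ^ 2 / (lam - l1)) := by
  have hμ : 0 < lam - l1 := by linarith [S.lt]
  have h1 := S.energy_perp_solution_le' hx hxs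
  have h2 : (inner ℝ v1 x / (lam - l1)) ^ 2 * (lam - l1) = inner ℝ v1 x ^ 2 / (lam - l1) := by
    field_simp
  rw [S.energy_eq_add, S.inner_solution hxs, h2]
  have h3 : 0 ≤ inner ℝ v1 x ^ 2 / (lam - l1) := by positivity
  nlinarith

/-- One approximate step of inverse iteration. -/
theorem approx_step (S : ShiftHyp D lam l1 v1) {g : ℝ} (hg0 : 0 ≤ g) (hg : g ≤ 1 / 10)
    {x xs xh : Vec d} (hx : Aligned D lam l1 v1 g x) (hxs : lam • xs - Sigma D xs = x)
    (hxh : energy D lam (xh - xs) ≤ g / 100 * (inner ℝ v1 x ^ 2 / (lam - l1))) :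
    89 / 100 / (lam - l1) ^ 2 ≤ ‖xh‖ ^ 2 ∧
    energy D lam (perp v1 xh) ≤ g / 4 * (inner ℝ v1 xh ^ 2 * (lam - l1)) := by
  have hμ : 0 < lam - l1 := by linarith [S.lt]
  have hα := S.inner_sq_ge hg hx
  set μ := lam - l1 with hμ'
  set p := inner ℝ v1 x / μ with hp
  set t := inner ℝ v1 (xh - xs) with ht
  have hP : inner ℝ v1 x ^ 2 / μ = p ^ 2 * μ := by rw [hp]; field_simp
  have hβ : inner ℝ v1 xh = p + t := by
    rw [hp, ← S.inner_solution hxs, ht, inner_sub_right]; ring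
  have he := S.energy_eq_add (xh - xs)
  have he0 := S.energy_perp_nonneg (xh - xs)
  have hz := S.energy_perp_solution_le' hx hxs
  rw [hP] at hxh hz
  rw [← ht, ← hμ'] at he
  -- The energy of the solver error also contains its component along `v1`.
  have ht2 : t ^ 2 ≤ g / 100 * p ^ 2 := le_of_mul_le_mul_right (by linarith) hμ
  have ht3 : t ^ 2 ≤ p ^ 2 / 1000 := by nlinarith [sq_nonneg p]
  -- The difference of the two sides is `(p + 10 t)² / 10 + 9 (p² / 1000 - t²)`.
  have hβ2 : 891 / 1000 * p ^ 2 ≤ (p + t) ^ 2 := by nlinarith [sq_nonneg (p + 10 * t)]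
  constructor
  · have h1 := norm_sq_perp S.norm_eq xh
    rw [hβ] at h1
    have h2 : 89 / 100 / μ ^ 2 ≤ 891 / 1000 * p ^ 2 := by
      rw [hp, div_pow, ← mul_div_assoc]
      gcongr
      linarith
    linarith [sq_nonneg ‖perp v1 xh‖]
  · rw [hβ]
    have h1 : perp v1 xh = perp v1 xs + perp v1 (xh - xs) := by rw [← perp_add]; congr 1; abel
    rw [h1]
    refine (S.energy_add_le _ _).trans ?_
    have h2 : 0 ≤ t ^ 2 * μ := by positivity
    have h3 : 0 ≤ g * (p ^ 2 * μ) := by positivity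
    have h4 : g / 4 * (891 / 1000 * p ^ 2 * μ) ≤ g / 4 * ((p + t) ^ 2 * μ) := by gcongr
    linarith

theorem aligned_normalize {g : ℝ} {x : Vec d} (hx : x ≠ 0)
    (h : energy D lam (perp v1 x) ≤ g * (inner ℝ v1 x ^ 2 * (lam - l1))) :
    Aligned D lam l1 v1 g ((1 / ‖x‖) • x) := by
  refine ⟨by rw [norm_smul, norm_div, norm_one, norm_norm,
    one_div_mul_cancel (norm_ne_zero_iff.mpr hx)], ?_⟩
  rw [perp_smul, energy_smul, inner_smul_right]
  have := mul_le_mul_of_nonneg_left h (sq_nonneg (1 / ‖x‖))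
  linarith

end ShiftHyp

end Contraction

/-! ### Samples, running time and unit norm, on every tape. -/

section Costs

variable {d : ℕ} {α δ : Type}

theorem loop_sampleStep_cost (n c : ℕ) (step : Vec d → α → α) (s : α) (ω : Tape d)
    (r : Counters) :
    (loop n (sampleStep c step) s ω r).2 =
      ⟨r.samples + n, r.seeds, r.time + n * (d + c + 1)⟩ := by
  induction n generalizing s r with
  | zero => simp [loop, pure_apply]
  | succ n ih =>
    rw [loop_succ, bind_apply, bind_apply, ih]
    simp only [sampleStep, bind_apply, nextSample, tick, Counters.mk.injEq, true_and]
    constructor <;> ring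

theorem ssvrgIter_cost (lam : ℝ) (b : Vec d) (p : SvrgParams) (y0 : Vec d) (ω : Tape d)
    (r : Counters) : ∃ n ≤ p.m,
      (ssvrgIter lam b p y0 ω r).2.samples = r.samples + p.k + n ∧
      (ssvrgIter lam b p y0 ω r).2.time =
        r.time + (2 * d + 2) + p.k * (8 * d + 1) + n * (17 * d + 1) := by
  refine ⟨_, min_le_left p.m (⌊(ω.2 r.seeds : ℝ) * p.m⌋₊ + 1), ?_, ?_⟩ <;>
  · rw [ssvrgIter_eq]
    simp only [bind_apply, loop_sampleStep_cost, tick, uniformUpTo]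
    try ring

theorem batchMean_cost (k : ℕ) (u : Vec d) (ω : Tape d) (r : Counters) :
    (batchMean k u ω r).2 = ⟨r.samples + k, r.seeds, r.time + k * (3 * d + 3) + 1⟩ := by
  rw [batchMean_eq, bind_apply]
  simp only [tick, loop_sampleStep_cost, Counters.mk.injEq, true_and]
  ring

/-- The costs of a loop over a list of programs, each of which reads at least one sample. -/
theorem loopList_cost {K : ℕ} (ps : List δ) {f : δ → α → Alg d α} {N : δ → ℕ}
    (hf : ∀ p y ω c, c.samples ≤ (f p y ω c).2.samples ∧
      (f p y ω c).2.samples ≤ c.samples + N p ∧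
      -- Amortisation: `time - K * samples` does not grow, written without truncated subtraction;
      -- the `1` pays for the loop overhead.
      (f p y ω c).2.time + 1 + K * c.samples ≤ c.time + K * (f p y ω c).2.samples)
    (s : α) (ω : Tape d) (c : Counters) :
    c.samples ≤ (loopList ps f s ω c).2.samples ∧
      (loopList ps f s ω c).2.samples ≤ c.samples + (ps.map N).sum ∧
      (loopList ps f s ω c).2.time + K * c.samples ≤
        c.time + K * (loopList ps f s ω c).2.samples := by
  induction ps generalizing s c with
  | nil => simp [loopList, pure_apply]
  | cons p ps ih =>
    obtain ⟨h1, h2, h3⟩ := hf p s ω c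
    obtain ⟨h4, h5, h6⟩ := ih (f p s ω c).1
      ⟨(f p s ω c).2.samples, (f p s ω c).2.seeds, (f p s ω c).2.time + 1⟩
    simp only [loopList, bind_apply, tick, List.map_cons, List.sum_cons] at *
    omega

theorem loopList_induction (ps : List δ) {f : δ → α → Alg d α} {P : α → Prop}
    (hf : ∀ p y ω c, P y → P (f p y ω c).1) {s : α} (hs : P s) (ω : Tape d) (c : Counters) :
    P (loopList ps f s ω c).1 := by
  induction ps generalizing s c with
  | nil => exact hs
  | cons p ps ih =>
    simp only [loopList, bind_apply, tick]
    exact ih (hf p s ω c hs) _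

/-- The number of samples that a solve may use. -/
def solveSamples (ps : List SvrgParams) : ℕ := (ps.map fun p => p.k + p.m).sum

theorem solve_cost (hd : 2 ≤ d) (lam : ℝ) (ps : List SvrgParams) (b : Vec d) (ω : Tape d)
    (c : Counters) : c.samples ≤ (solve lam ps b ω c).2.samples ∧
      (solve lam ps b ω c).2.samples ≤ c.samples + solveSamples ps ∧
      (solve lam ps b ω c).2.time + 30 * d * c.samples ≤
        c.time + d + 30 * d * (solve lam ps b ω c).2.samples := by
  refine loopList_cost ps (f := fun p y => ssvrgIter lam b p y) (fun p y ω c => ?_) 0 ω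
    ⟨c.samples, c.seeds, c.time + d⟩
  obtain ⟨n, hn, h1, h2⟩ := ssvrgIter_cost lam b p y ω c
  rw [h1, h2]
  refine ⟨by omega, by omega, ?_⟩
  have hk := p.k_pos
  nlinarith [Nat.mul_le_mul hd hk, Nat.mul_le_mul_left n hd, Nat.mul_le_mul_left p.k hd,
    Nat.mul_le_mul_left d hk]

/-- The batch has at least one sample, to which all fixed overhead of the round is charged,
including the `d` operations left over by `solve_cost`. -/
theorem powerRound_cost (hd : 2 ≤ d) (lam lamHat : ℝ) {p : RoundParams} (hp : p.batches = 1)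
    (x : Vec d) (ω : Tape d) (c : Counters) :
    c.samples ≤ (powerRound lam lamHat p x ω c).2.samples ∧
      (powerRound lam lamHat p x ω c).2.samples ≤
        c.samples + (solveSamples p.svrg + p.batchSize) ∧
      (powerRound lam lamHat p x ω c).2.time + 1 + 30 * d * c.samples ≤
        c.time + 30 * d * (powerRound lam lamHat p x ω c).2.samples := by
  obtain ⟨h1, h2, h3⟩ := solve_cost hd lam p.svrg x ω c
  rw [powerRound_eq lam lamHat hp]
  simp only [bind_apply, tick, batchMean_cost]
  have hk := p.batchSize_pos
  refine ⟨by omega, by omega, ?_⟩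
  nlinarith [Nat.mul_le_mul hd hk, Nat.mul_le_mul_left p.batchSize hd, Nat.mul_le_mul_left d hk]

/-- The norm test keeps a zero solver output from being accepted, so no probability is involved. -/
theorem norm_powerRound {lam lamHat : ℝ} (hlam : 0 < lam - lamHat) {p : RoundParams}
    (hp : p.batches = 1) {x : Vec d} (hx : ‖x‖ = 1) (ω : Tape d) (c : Counters) :
    ‖(powerRound lam lamHat p x ω c).1‖ = 1 := by
  have key : ∀ (P : Prop) [Decidable P] (y : Vec d), (P → (2 / 3) / (lam - lamHat) ≤ ‖y‖) →
      ‖if P then (1 / ‖y‖) • y else x‖ = 1 := by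
    intro P _ y hy
    split_ifs with h
    · have h0 : 0 < ‖y‖ := (by positivity : 0 < (2 / 3) / (lam - lamHat)).trans_le (hy h)
      rw [norm_smul, norm_div, norm_one, norm_norm, one_div_mul_cancel h0.ne']
    · exact hx
  rw [powerRound_eq lam lamHat hp]
  exact key _ _ fun h => h.2

theorem loopList_map {γ : Type} (g : γ → δ) (ps : List γ) (f : δ → α → Alg d α) (s : α) :
    loopList (ps.map g) f s = loopList ps (fun p => f (g p)) s := by
  induction ps generalizing s with
  | nil => rfl
  | cons p ps ih => simp only [List.map_cons, loopList, ih]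

end Costs

/-! ### Sample counts of the schedule. -/

section Schedule

/-- The parameters of a round with `n` SVRG steps. -/
noncomputable def roundParam {S Δ : ℝ} (hS : 0 < S) (hΔ : 0 < Δ) (n : ℕ) : RoundParams where
  svrg := (List.range n).map (svrgParam hS hΔ)
  batchSize := ⌈2 ^ n * (S / Δ)⌉₊
  batches := 1
  batchSize_pos := Nat.ceil_pos.mpr (by positivity)
  batches_pos := one_pos

theorem ceil_le_two_mul {x : ℝ} (hx : 1 ≤ x) : (⌈x⌉₊ : ℝ) ≤ 2 * x := by
  linarith [Nat.ceil_lt_add_one (zero_le_one.trans hx)]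

/-- Step `n` uses at most `256 · 2ⁿ + 16384 ≤ 16640 · 2ⁿ` times `S / Δ`, where each ceiling costs a
factor `2`. The sum is geometric, and the constant `m` is absorbed by `2ⁿ ≥ 1`. -/
theorem solveSamples_le {S Δ : ℝ} (hS : 0 < S) (hΔ : 0 < Δ) (hQ : 1 ≤ S / Δ) (n : ℕ) :
    (solveSamples ((List.range n).map (svrgParam hS hΔ)) : ℝ) ≤ 16640 * 2 ^ n * (S / Δ) := by
  induction n with
  | zero => simp [solveSamples]; positivity
  | succ n ih =>
    have h2 : (1 : ℝ) ≤ 2 ^ n := one_le_pow₀ (by norm_num)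
    have h3 : 1 * 1 ≤ 2 ^ n * (S / Δ) := mul_le_mul h2 hQ (by norm_num) (by positivity)
    have hk : ((svrgParam hS hΔ n).k : ℝ) ≤ 2 * (128 * 2 ^ n * (S / Δ)) :=
      ceil_le_two_mul (by linarith)
    have hm : ((svrgParam hS hΔ n).m : ℝ) ≤ 2 * (8192 * (S / Δ)) := ceil_le_two_mul (by linarith)
    have e : solveSamples ((List.range (n + 1)).map (svrgParam hS hΔ)) =
        solveSamples ((List.range n).map (svrgParam hS hΔ)) +
          ((svrgParam hS hΔ n).k + (svrgParam hS hΔ n).m) := by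
      simp [solveSamples, List.range_succ]
    rw [e]
    push_cast
    have h4 : 1 * (S / Δ) ≤ 2 ^ n * (S / Δ) := by gcongr
    rw [pow_succ]
    linarith

theorem sum_round_samples_le {S Δ : ℝ} (hS : 0 < S) (hΔ : 0 < Δ) (hQ : 1 ≤ S / Δ) (n T : ℕ) :
    ((((List.range T).map fun i => solveSamples (roundParam hS hΔ (n + i)).svrg +
      (roundParam hS hΔ (n + i)).batchSize).sum : ℕ) : ℝ) ≤
      16642 * 2 ^ n * 2 ^ T * (S / Δ) := by
  induction T with
  | zero => simp; positivity
  | succ T ih =>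
    have h2 : (1 : ℝ) ≤ 2 ^ (n + T) := one_le_pow₀ (by norm_num)
    have h3 : 1 * 1 ≤ 2 ^ (n + T) * (S / Δ) := mul_le_mul h2 hQ (by norm_num) (by positivity)
    have h4 : ((roundParam hS hΔ (n + T)).batchSize : ℝ) ≤ 2 * (2 ^ (n + T) * (S / Δ)) :=
      ceil_le_two_mul (by linarith)
    have h6 : (solveSamples (roundParam hS hΔ (n + T)).svrg : ℝ) ≤
      16640 * 2 ^ (n + T) * (S / Δ) := solveSamples_le hS hΔ hQ (n + T)
    rw [List.range_succ, List.map_append, List.sum_append, List.map_singleton,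
      List.sum_singleton, Nat.cast_add, Nat.cast_add]
    rw [pow_add] at h4 h6
    rw [pow_succ]
    linarith

end Schedule

/-! ### Failure probability of one round and of all rounds. -/

section Convergence

open scoped ENNReal

variable {d : ℕ} {D : Measure (Vec d)} {lam l1 : ℝ} {v1 : Vec d}

/-- The indicator of the vectors whose squared potential exceeds `4⁻ⁱ / 10`. -/
noncomputable def misaligned (D : Measure (Vec d)) (lam l1 : ℝ) (v1 : Vec d) (i : ℕ) :
    Vec d → ℝ≥0∞ :=
  Set.indicator {x | ShiftHyp.Aligned D lam l1 v1 ((1 / 4) ^ i / 10) x}ᶜ 1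

theorem measurable_misaligned (i : ℕ) : Measurable (misaligned D lam l1 v1 i) :=
  measurable_one.indicator (ShiftHyp.measurableSet_aligned _).compl

theorem misaligned_le_one (i : ℕ) (x : Vec d) : misaligned D lam l1 v1 i x ≤ 1 :=
  Set.indicator_le_self _ _ _

theorem misaligned_eq_zero {i : ℕ} {x : Vec d}
    (h : ShiftHyp.Aligned D lam l1 v1 ((1 / 4) ^ i / 10) x) : misaligned D lam l1 v1 i x = 0 :=
  Set.indicator_of_notMem (by simpa using h) _

theorem misaligned_eq_one {i : ℕ} {x : Vec d}
    (h : ¬ ShiftHyp.Aligned D lam l1 v1 ((1 / 4) ^ i / 10) x) : misaligned D lam l1 v1 i x = 1 :=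
  Set.indicator_of_mem (s := {x | ShiftHyp.Aligned D lam l1 v1 ((1 / 4) ^ i / 10) x}ᶜ) h 1

theorem SolverHyp.exists_solution {Δ v : ℝ} (H : SolverHyp D lam Δ v) (x : Vec d) :
    ∃ xs, lam • xs - Sigma D xs = x := by
  let B : Vec d →ₗ[ℝ] Vec d := lam • LinearMap.id - (Sigma D : Vec d →ₗ[ℝ] Vec d)
  have hB : Function.Injective B := by
    rw [injective_iff_map_eq_zero]
    intro w hw
    have h1 : energy D lam w = 0 := by
      change inner ℝ w (B w) = 0
      rw [hw, inner_zero_right]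
    have h2 := H.coercive w
    rw [h1] at h2
    have h3 : ‖w‖ ^ 2 ≤ 0 := by
      by_contra h
      exact absurd h2 (not_le.mpr (mul_pos H.pos (not_le.mp h)))
    exact norm_eq_zero.mp (pow_eq_zero_iff two_ne_zero |>.mp (le_antisymm h3 (sq_nonneg _)))
  exact LinearMap.injective_iff_surjective.mp hB x

theorem aligned_of_potential_le (A : ShiftHyp D lam l1 v1) {x0 : Vec d}
    (hx0 : inner ℝ v1 x0 ≠ 0) (hpot : potential D lam v1 x0 ≤ 1 / √10) :
    ShiftHyp.Aligned D lam l1 v1 (1 / 10) ((1 / ‖x0‖) • x0) := by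
  have hne : x0 ≠ 0 := by
    rintro rfl
    simp at hx0
  refine ShiftHyp.aligned_normalize hne ?_
  have hμ : 0 < lam - l1 := by linarith [A.lt]
  have e1 : energy D lam v1 = lam - l1 := by
    rw [energy, A.inner_shift, real_inner_self_eq_norm_sq, A.norm_eq]; simp
  have hE : 0 < energy D lam (inner ℝ v1 x0 • v1) := by
    rw [energy_smul, e1]; positivity
  have h : √(energy D lam (perp v1 x0)) / √(energy D lam (inner ℝ v1 x0 • v1)) ≤ 1 / √10 := hpot
  rw [← Real.sqrt_div (A.energy_perp_nonneg x0), one_div, ← Real.sqrt_inv,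
    Real.sqrt_le_sqrt_iff (by norm_num), div_le_iff₀ hE, energy_smul, e1] at h
  linarith

variable [IsProbabilityMeasure D] {lamHat v S : ℝ}

/-- An accurate solve and an accurate Rayleigh estimate make the round pass both tests and quarter
the squared potential. The thresholds are chosen so that Markov contributes `2000 · 4ⁱ / 2ⁿ` and
Chebyshev `900 / 2ⁿ`. -/
theorem SolverHyp.expect_misaligned_le (H : SolverHyp D lam (lam - lamHat) v)
    (A : ShiftHyp D lam l1 v1) (h1 : 10 / 11 * (lam - l1) ≤ lam - lamHat)
    (h2 : lam - lamHat ≤ lam - l1) (hS : 0 < S) (hSv : S = v * lam ^ 2 / (lam - lamHat))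
    (n i : ℕ) {x : Vec d} (hx : ShiftHyp.Aligned D lam l1 v1 ((1 / 4) ^ i / 10) x) :
    expect D (powerRound lam lamHat (roundParam hS H.pos n) x)
      (misaligned D lam l1 v1 (i + 1)) ≤ ENNReal.ofReal (2900 * 4 ^ i / 2 ^ n) := by
  obtain ⟨xs, hxs⟩ := H.exists_solution x
  have hΔ := H.pos
  set Δ := lam - lamHat with hΔ'
  set μ := lam - l1 with hμ'
  have hμ : 0 < μ := by linarith
  set g : ℝ := (1 / 4) ^ i / 10 with hg
  have hg0 : 0 < g := by positivity
  have hg1 : g ≤ 1 / 10 := by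
    have : (1 / 4 : ℝ) ^ i ≤ 1 := pow_le_one₀ (by norm_num) (by norm_num)
    rw [hg]; linarith
  have hg2 : (1 / 4 : ℝ) ^ (i + 1) / 10 = g / 4 := by rw [hg, pow_succ]; ring
  set P := inner ℝ v1 x ^ 2 / μ with hP
  have hα := A.inner_sq_ge hg1 hx
  have hP0 : 0 < P := div_pos (by linarith) hμ
  have hX := A.energy_solution_le hg1 hx hxs
  have hX0 := H.energy_nonneg xs
  refine (H.expect_powerRound_le (p := roundParam hS H.pos n) rfl
    (e := (1 / 2) ^ n * energy D lam xs) (τ := g / 100 * P) (t := Δ / 30) (by positivity)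
    (by positivity) (by positivity) (H.expect_solve_le hS hSv hxs n) (measurable_misaligned _)
    (misaligned_le_one _) fun xh hxh => ?_).trans (ENNReal.ofReal_le_ofReal ?_)
  · obtain ⟨hn, he⟩ := A.approx_step hg0.le hg1 hx hxs hxh
    have hne : xh ≠ 0 := by
      rintro rfl
      rw [norm_zero] at hn
      have : 0 < 89 / 100 / (lam - l1) ^ 2 := by positivity
      norm_num at hn
      linarith
    refine ⟨hne, fun r hr => ?_⟩
    have hal := ShiftHyp.aligned_normalize hne he
    have hR := A.rayleigh_ge (by positivity) hal
    have hgμ : g / 4 * μ ≤ 1 / 10 / 4 * μ := by gcongr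
    -- The test allows `Δ + Δ / 6` below `lam`; the true deficit is at most `41 / 40 μ ≤ 1.1275 Δ`
    -- and the estimation error `Δ / 30`.
    have hc1 : lamHat - Δ / 6 ≤ r := by
      have := (abs_le.mp hr).1
      linarith
    have hc2 : 2 / 3 / Δ ≤ ‖xh‖ := by
      refine le_of_sq_le_sq (le_trans ?_ hn) (norm_nonneg _)
      rw [div_pow, div_le_div_iff₀ (by positivity) (by positivity)]
      have : μ ^ 2 ≤ (11 / 10 * Δ) ^ 2 := by
        gcongr
        linarith
      nlinarith
    rw [if_pos ⟨hc1, hc2⟩]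
    exact misaligned_eq_zero (by rw [hg2]; exact hal)
  · have b1 : (1 / 2) ^ n * energy D lam xs / (g / 100 * P) ≤ 2000 * 4 ^ i / 2 ^ n := by
      rw [div_le_iff₀ (by positivity)]
      calc (1 / 2) ^ n * energy D lam xs ≤ (1 / 2) ^ n * (2 * P) := by gcongr
        _ = _ := by
          rw [hg, one_div_pow, one_div_pow]
          field_simp
          norm_num
    have b2 : v * lam ^ 2 / ((roundParam hS H.pos n).batchSize : ℝ) / (Δ / 30) ^ 2 ≤
        900 / 2 ^ n := by
      have hb : 2 ^ n * (S / Δ) ≤ ((roundParam hS H.pos n).batchSize : ℝ) := Nat.le_ceil _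
      have hq : v * lam ^ 2 = S * Δ := by rw [hSv]; field_simp
      have hb0 : (0 : ℝ) < (roundParam hS H.pos n).batchSize := by
        exact_mod_cast (roundParam hS H.pos n).batchSize_pos
      rw [hq, div_div, div_le_div_iff₀ (by positivity) (by positivity)]
      have e : S * Δ * 2 ^ n = Δ ^ 2 * (2 ^ n * (S / Δ)) := by field_simp
      rw [e]
      nlinarith [mul_le_mul_of_nonneg_left hb (sq_nonneg Δ)]
    have b3 : (900 : ℝ) / 2 ^ n ≤ 900 * 4 ^ i / 2 ^ n := by
      have : (1 : ℝ) ≤ 4 ^ i := one_le_pow₀ (by norm_num)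
      gcongr
      linarith
    have b4 : (2900 : ℝ) * 4 ^ i / 2 ^ n = 2000 * 4 ^ i / 2 ^ n + 900 * 4 ^ i / 2 ^ n := by ring
    linarith

/-- A union bound: with one more SVRG step in each round, round `i` fails with probability at most
`2900 · 2ⁱ / 2ⁿ`, and these sum to less than `2900 · 2ᵀ / 2ⁿ`. -/
theorem SolverHyp.expect_rounds_le (H : SolverHyp D lam (lam - lamHat) v)
    (A : ShiftHyp D lam l1 v1) (h1 : 10 / 11 * (lam - l1) ≤ lam - lamHat)
    (h2 : lam - lamHat ≤ lam - l1) (hS : 0 < S) (hSv : S = v * lam ^ 2 / (lam - lamHat))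
    (n T : ℕ) {x : Vec d} (hx : ShiftHyp.Aligned D lam l1 v1 (1 / 10) x) :
    expect D (loopList (List.range T)
        (fun i => powerRound lam lamHat (roundParam hS H.pos (n + i))) x)
      (misaligned D lam l1 v1 T) ≤ ENNReal.ofReal (2900 * 2 ^ T / 2 ^ n) := by
  induction T with
  | zero =>
    simp only [List.range_zero, loopList, expect_pure]
    rw [misaligned_eq_zero (by simpa using hx)]
    exact zero_le
  | succ T ih =>
    rw [List.range_succ, expect_loopList_concat _ _ (fun i => Streaming.powerRound _ _ rfl) _
      (measurable_misaligned _)]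
    refine (expect_mono (G := fun y => misaligned D lam l1 v1 T y +
      ENNReal.ofReal (2900 * 4 ^ T / 2 ^ (n + T))) fun y => ?_).trans ?_
    · by_cases hy : ShiftHyp.Aligned D lam l1 v1 ((1 / 4) ^ T / 10) y
      · exact le_add_left (H.expect_misaligned_le A h1 h2 hS hSv _ _ hy)
      -- After an earlier failure nothing is claimed: the indicator already equals `1`.
      · rw [misaligned_eq_one hy]
        exact le_add_right ((expect_mono (misaligned_le_one _)).trans (expect_const_le _ 1))
    · rw [expect_add_const]
      refine (add_le_add_left ih _).trans ?_
      rw [← ENNReal.ofReal_add (by positivity) (by positivity)]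
      refine ENNReal.ofReal_le_ofReal (le_of_eq ?_)
      rw [pow_add, pow_succ, show (4 : ℝ) = 2 * 2 by norm_num, mul_pow]
      field_simp
      ring

end Convergence

/-! ### Choice of the schedule and the final bounds. -/

section MainTheorem

variable {d : ℕ}

theorem le_pow_clog_ceil {b : ℕ} (hb : 1 < b) (x : ℝ) : x ≤ (b : ℝ) ^ Nat.clog b ⌈x⌉₊ :=
  (Nat.le_ceil x).trans (by exact_mod_cast Nat.le_pow_clog hb _)

theorem pow_clog_ceil_le {b : ℕ} (hb : 1 < b) {x : ℝ} (hx : 1 < x) :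
    (b : ℝ) ^ Nat.clog b ⌈x⌉₊ ≤ 2 * b * x := by
  have h1 : 1 < ⌈x⌉₊ := Nat.lt_ceil.mpr (by simpa using hx)
  have h2 := Nat.pow_pred_clog_lt_self hb h1
  have h3 : (b : ℝ) ^ (Nat.clog b ⌈x⌉₊).pred ≤ 2 * x :=
    le_trans (by exact_mod_cast h2.le) (ceil_le_two_mul hx.le)
  have h4 : Nat.clog b ⌈x⌉₊ = (Nat.clog b ⌈x⌉₊).pred + 1 :=
    (Nat.succ_pred_eq_of_pos (Nat.clog_pos hb h1)).symm
  rw [h4, pow_succ]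
  nlinarith [(Nat.cast_nonneg b : (0 : ℝ) ≤ b)]

open Classical in
/-- The schedule of the online shifted-and-inverted power method. -/
noncomputable def schedule (lam lamHat v ε δ : ℝ) : List RoundParams :=
  -- The test makes the rule total; it succeeds under the hypotheses of the theorem. The offset
  -- `clog 4` in the number of SVRG steps cancels the factor `2ᵀ` of the union bound, and `clog 2`
  -- provides `δ`.
  if h : 0 < v * lam ^ 2 / (lam - lamHat) ∧ 0 < lam - lamHat then
    (List.range (Nat.clog 4 ⌈(lam - lamHat) / (lam * ε)⌉₊)).map fun i => roundParam h.1 h.2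
      (Nat.clog 2 ⌈4096 / δ⌉₊ + Nat.clog 4 ⌈(lam - lamHat) / (lam * ε)⌉₊ + i)
  else []

theorem solverHyp_of_gap (hd : 2 ≤ d) {D : Measure (Vec d)} [IsProbabilityMeasure D]
    (h4 : Integrable (fun a => ‖a‖ ^ 4) D) (hgap : 0 < gap hd D) {lam Δ : ℝ} (hΔ : 0 < Δ)
    (hlam : Δ ≤ lam - lam1 hd D) : SolverHyp D lam Δ (nvar D) where
  moment := h4
  pos := hΔ
  le := by linarith [lam1_pos hd h4 hgap]
  one_le := one_le_nvar hd h4 hgap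
  coercive w := by
    rw [energy_eq]
    nlinarith [inner_Sigma_le hd D w, mul_le_mul_of_nonneg_right hlam (sq_nonneg ‖w‖)]
  fourth w := by
    have h1 := lam1_pos hd h4 hgap
    have h2 := one_le_nvar hd h4 hgap
    refine (integral_outer_sq_le hd h4 hgap w).trans ?_
    have h3 : lam1 hd D ≤ lam := by linarith
    gcongr

/-- The factor `100` comes from `lam - λ₁ ≤ gap λ₁ / 100` together with `lam - λ₂ ≥ gap λ₁`. -/
theorem shiftHyp_of_gap (hd : 2 ≤ d) {D : Measure (Vec d)} [IsProbabilityMeasure D]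
    (h4 : Integrable (fun a => ‖a‖ ^ 4) D) (hgap : 0 < gap hd D) {v1 : Vec d} (hv1 : ‖v1‖ = 1)
    (hS : Sigma D v1 = lam1 hd D • v1) {lam : ℝ} (h1 : lam1 hd D < lam)
    (h2 : lam ≤ (1 + gap hd D / 100) * lam1 hd D) : ShiftHyp D lam (lam1 hd D) v1 where
  norm_eq := hv1
  eigen := hS
  lt := h1
  le_perp w hw := by
    have hl := lam1_pos hd h4 hgap
    have hg : gap hd D * lam1 hd D = lam1 hd D - lam2 hd D := div_mul_cancel₀ _ hl.ne'
    have hlt : lam2 hd D < lam1 hd D := by nlinarith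
    rw [energy_eq]
    have h3 := inner_Sigma_le_of_orthogonal hd hlt hv1 hS hw
    have h5 : 100 * (lam - lam1 hd D) ≤ lam - lam2 hd D := by linarith
    nlinarith [mul_le_mul_of_nonneg_right h5 (sq_nonneg ‖w‖)]

theorem gap_le_one (hd : 2 ≤ d) {D : Measure (Vec d)} [IsProbabilityMeasure D]
    (h4 : Integrable (fun a => ‖a‖ ^ 4) D) (hgap : 0 < gap hd D) : gap hd D ≤ 1 := by
  rw [gap, div_le_one (lam1_pos hd h4 hgap)]
  have : 0 ≤ lam2 hd D := eig_nonneg h4 _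
  linarith

theorem onlineSI_eq (lam lamHat : ℝ) (sched : List RoundParams) (x0 : Vec d) :
    onlineSI lam lamHat sched x0 = tick (3 * d + 2) ((1 / ‖x0‖) • x0, ‖x0‖) >>= fun u =>
      loopList sched (fun p x => powerRound lam lamHat p x) u.1 := by
  rw [onlineSI, normalize_eq]

/-- The sample bound, in terms of `Δ = lam - lamHat` and the relative gap `γ`. -/
theorem samples_bound {lam l1 Δ γ v ε δ : ℝ} (hl1 : 0 < l1) (hγ0 : 0 < γ) (hγ1 : γ ≤ 1)
    (hlam0 : l1 ≤ lam) (hlam : lam ≤ (1 + γ / 100) * l1) (hΔ : 0 < Δ)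
    (hlow : γ / 150 * l1 ≤ 11 / 10 * Δ)
    (hv : 1 ≤ v) (hε0 : 0 < ε) (hδ0 : 0 < δ) (hδ1 : δ < 1)
    (hr : 1 < Δ / (lam * ε)) :
    16642 * 2 ^ (Nat.clog 2 ⌈4096 / δ⌉₊ + Nat.clog 4 ⌈Δ / (lam * ε)⌉₊) *
      2 ^ Nat.clog 4 ⌈Δ / (lam * ε)⌉₊ * (v * lam ^ 2 / Δ / Δ) ≤
    10 ^ 12 * (v / γ * ((Real.log (1 / δ) + max 0 (Real.log (Real.log (1 / ε)))) / γ +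
      1 / (δ ^ 2 * ε))) := by
  have hlam' : 0 < lam := by linarith
  have b1 := pow_clog_ceil_le (b := 2) (by norm_num)
    (show 1 < 4096 / δ by rw [lt_div_iff₀ hδ0]; linarith)
  have b2 := pow_clog_ceil_le (b := 4) (by norm_num) hr
  push_cast at b1 b2
  have e : (2 : ℝ) ^ (Nat.clog 2 ⌈4096 / δ⌉₊ + Nat.clog 4 ⌈Δ / (lam * ε)⌉₊) *
      2 ^ Nat.clog 4 ⌈Δ / (lam * ε)⌉₊ =
      2 ^ Nat.clog 2 ⌈4096 / δ⌉₊ * 4 ^ Nat.clog 4 ⌈Δ / (lam * ε)⌉₊ := by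
    rw [pow_add, show (4 : ℝ) = 2 * 2 by norm_num, mul_pow]; ring
  -- From `lam ≤ 1.01 l1` and `Δ ≥ γ l1 / 165`; the product `1.01 · 165` is below `167`.
  have hratio : lam / Δ ≤ 167 / γ := by
    rw [div_le_div_iff₀ hΔ hγ0]
    nlinarith
  -- The schedule achieves `1 / (δ ε)`; it is weakened here to the stated `1 / (δ² ε)`, and the
  -- logarithmic term is only used as nonnegative.
  have hδδ : 1 / (δ * ε) ≤ 1 / (δ ^ 2 * ε) := by
    refine one_div_le_one_div_of_le (by positivity) ?_
    gcongr
    nlinarith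
  have hlog : 0 ≤ (Real.log (1 / δ) + max 0 (Real.log (Real.log (1 / ε)))) / γ := by
    have : 0 ≤ Real.log (1 / δ) := Real.log_nonneg (by rw [le_div_iff₀ hδ0]; linarith)
    have : 0 ≤ max 0 (Real.log (Real.log (1 / ε))) := le_max_left _ _
    positivity
  rw [mul_assoc 16642, e]
  calc 16642 * (2 ^ Nat.clog 2 ⌈4096 / δ⌉₊ * 4 ^ Nat.clog 4 ⌈Δ / (lam * ε)⌉₊) *
        (v * lam ^ 2 / Δ / Δ)
      ≤ 16642 * ((2 * 2 * (4096 / δ)) * (2 * 4 * (Δ / (lam * ε)))) * (v * lam ^ 2 / Δ / Δ) := by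
        gcongr
    _ = 16642 * 16384 * 8 * v * (lam / Δ) * (1 / (δ * ε)) := by field_simp; ring
    _ ≤ 16642 * 16384 * 8 * v * (167 / γ) * (1 / (δ ^ 2 * ε)) := by gcongr
    _ = 16642 * 16384 * 8 * 167 * (v / γ * (0 + 1 / (δ ^ 2 * ε))) := by ring
    _ ≤ _ := by
        gcongr
        norm_num

theorem measure_aligned_ge {D : Measure (Vec d)} [IsProbabilityMeasure D]
    {lam lamHat l1 v ε δ : ℝ} {v1 x0 : Vec d} (H : SolverHyp D lam (lam - lamHat) v)
    (A : ShiftHyp D lam l1 v1) (h1 : 10 / 11 * (lam - l1) ≤ lam - lamHat)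
    (h2 : lam - lamHat ≤ lam - l1) (hl1 : 0 < l1) (hlam : lam ≤ 101 / 100 * l1)
    (hx0 : inner ℝ v1 x0 ≠ 0) (hpot : potential D lam v1 x0 ≤ 1 / √10)
    (hε : 0 < ε) (hδ : 0 < δ) :
    ENNReal.ofReal (1 - δ) ≤ tapeLaw D {ω | (1 - ε) * l1 ≤
      inner ℝ (run lam lamHat (schedule lam lamHat v ε δ) x0 ω).1
        (Sigma D (run lam lamHat (schedule lam lamHat v ε δ) x0 ω).1)} := by
  have hΔ := H.pos
  have hlam0 : 0 < lam := hΔ.trans_le H.le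
  have hS : 0 < v * lam ^ 2 / (lam - lamHat) := by
    have := zero_lt_one.trans_le H.one_le
    positivity
  set T := Nat.clog 4 ⌈(lam - lamHat) / (lam * ε)⌉₊ with hT
  set n := Nat.clog 2 ⌈4096 / δ⌉₊ with hn
  set x : Vec d := (1 / ‖x0‖) • x0 with hx
  set p : Alg d (Vec d) := loopList (List.range T)
    (fun i => powerRound lam lamHat (roundParam hS hΔ (n + T + i))) x with hp
  have hstr : Streaming D fun _ : Unit => p :=
    Streaming.loopList _ (f := fun (_ : Unit) i =>
      powerRound lam lamHat (roundParam hS hΔ (n + T + i)))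
      (fun i => (Streaming.powerRound _ _ rfl).comp measurable_snd) measurable_const
  have hrun : ∀ ω, (run lam lamHat (schedule lam lamHat v ε δ) x0 ω).1 =
      (p ω ⟨0, 0, 0⟩).1 := by
    intro ω
    rw [run, onlineSI_eq, bind_apply, schedule, dif_pos ⟨hS, hΔ⟩]
    simp only [loopList_map, tick]
    -- Normalising `x0` advances the clock but reads no tape, so by equivariance the value is the
    -- one from zero counters.
    have h := congrArg Prod.fst (hstr.equivariant () ω ⟨0, 0, 0 + (3 * d + 2)⟩)
    rwa [Tape.shift_zero] at h
  have hexp := H.expect_rounds_le A h1 h2 hS rfl (n + T) T (aligned_of_potential_le A hx0 hpot)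
  set good := {y | ShiftHyp.Aligned D lam l1 v1 ((1 / 4) ^ T / 10) y} with hgood
  have hgm : MeasurableSet good := ShiftHyp.measurableSet_aligned _
  have hpm : Measurable fun ω => (p ω ⟨0, 0, 0⟩).1 :=
    hstr.measurable_val.comp (by fun_prop : Measurable fun ω : Tape d => ((), ω))
  have hbad : tapeLaw D {ω | (p ω ⟨0, 0, 0⟩).1 ∈ good}ᶜ ≤ ENNReal.ofReal δ := by
    have hE : MeasurableSet {ω | (p ω ⟨0, 0, 0⟩).1 ∈ good} := hpm hgm
    have e : expect D p (misaligned D lam l1 v1 T) =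
        tapeLaw D {ω | (p ω ⟨0, 0, 0⟩).1 ∈ good}ᶜ :=
      Eq.trans rfl (lintegral_indicator_one hE.compl)
    rw [← e]
    refine hexp.trans (ENNReal.ofReal_le_ofReal ?_)
    rw [div_le_iff₀ (by positivity), pow_add]
    have h := le_pow_clog_ceil (b := 2) (by norm_num) (4096 / δ)
    rw [div_le_iff₀ hδ] at h
    push_cast at h
    -- The choice of `4096` leaves room over the `2900` of the union bound.
    have h' : (2900 : ℝ) ≤ δ * 2 ^ n := by linarith
    nlinarith [(by positivity : (0 : ℝ) < 2 ^ T)]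
  have hsub : {ω | (p ω ⟨0, 0, 0⟩).1 ∈ good} ⊆ {ω | (1 - ε) * l1 ≤
      inner ℝ (run lam lamHat (schedule lam lamHat v ε δ) x0 ω).1
        (Sigma D (run lam lamHat (schedule lam lamHat v ε δ) x0 ω).1)} := by
    intro ω hω
    change (1 - ε) * l1 ≤ _
    rw [hrun]
    refine le_trans ?_ (A.rayleigh_ge (by positivity) hω)
    have h := le_pow_clog_ceil (b := 4) (by norm_num) ((lam - lamHat) / (lam * ε))
    rw [← hT, div_le_iff₀ (by positivity)] at h
    push_cast at h
    -- The final loss `4⁻ᵀ (lam - l1) / 10` is thus at most `0.11 lam ε`, which is below `ε l1` as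
    -- `lam ≤ 1.01 l1`.
    have h3 : (1 / 4 : ℝ) ^ T * (lam - lamHat) ≤ lam * ε := by
      rw [one_div_pow, one_div_mul_eq_div, div_le_iff₀ (by positivity)]
      linarith
    have h4 : (1 / 4 : ℝ) ^ T * (lam - l1) ≤ (1 / 4 : ℝ) ^ T * (11 / 10 * (lam - lamHat)) := by
      gcongr
      linarith
    nlinarith [mul_le_mul_of_nonneg_right hlam hε.le, mul_pos hl1 hε]
  refine le_trans ?_ (measure_mono hsub)
  rw [ENNReal.ofReal_sub _ hδ.le, ENNReal.ofReal_one, tsub_le_iff_right]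
  have h5 := measure_add_measure_compl (μ := tapeLaw D) (hpm hgm)
  rw [measure_univ] at h5
  exact h5.ge.trans (add_le_add_right hbad _)

end MainTheorem

end OnlinePCA

open OnlinePCA

theorem mainTheorem3 :
    ∃ C : ℝ, 0 < C ∧
    ∃ sched : (lam lamHat v ε δ : ℝ) → List OnlinePCA.RoundParams,
    ∀ (d : ℕ) (hd : 2 ≤ d) (D : Measure (OnlinePCA.Vec d)) [IsProbabilityMeasure D],
      Integrable (fun a => ‖a‖ ^ 4) D →
      0 < OnlinePCA.gap hd D →
    ∀ v1 : OnlinePCA.Vec d, ‖v1‖ = 1 →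
      OnlinePCA.Sigma D v1 = OnlinePCA.lam1 hd D • v1 →
    ∀ lam lamHat : ℝ,
      (1 + OnlinePCA.gap hd D / 150) * OnlinePCA.lam1 hd D ≤ lam →
      lam ≤ (1 + OnlinePCA.gap hd D / 100) * OnlinePCA.lam1 hd D →
      10 / 11 * (lam - OnlinePCA.lam1 hd D) ≤ lam - lamHat →
      lam - lamHat ≤ lam - OnlinePCA.lam1 hd D →
    ∀ x0 : OnlinePCA.Vec d, inner ℝ v1 x0 ≠ 0 →
      OnlinePCA.potential D lam v1 x0 ≤ 1 / Real.sqrt 10 →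
    ∀ ε δ : ℝ, 0 < ε → ε < 1 → 0 < δ → δ < 1 →
    let result := OnlinePCA.run lam lamHat (sched lam lamHat (OnlinePCA.nvar D) ε δ) x0
    (∀ ω, ‖(result ω).1‖ = 1) ∧
    ENNReal.ofReal (1 - δ) ≤ OnlinePCA.tapeLaw D
      {ω | (1 - ε) * OnlinePCA.lam1 hd D ≤
        inner ℝ (result ω).1 (OnlinePCA.Sigma D (result ω).1)} ∧
    (∀ ω, ((result ω).2.samples : ℝ) ≤
      C * (OnlinePCA.nvar D / OnlinePCA.gap hd D *
        ((Real.log (1 / δ) + max 0 (Real.log (Real.log (1 / ε)))) / OnlinePCA.gap hd D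
          + 1 / (δ ^ 2 * ε)))) ∧
    (∀ ω, ((result ω).2.time : ℝ) ≤ C * d * ((result ω).2.samples + 1)) := by
  -- The sample bound needs `16642 · 16384 · 8 · 167 ≈ 3.7 · 10¹¹`.
  refine ⟨10 ^ 12, by norm_num, OnlinePCA.schedule, ?_⟩
  intro d hd D _ h4 hgap v1 hv1 hSv lam lamHat hlo hhi h1 h2 x0 hx0 hpot ε δ hε _ hδ hδ1
  have hl1 := lam1_pos hd h4 hgap
  have hg1 := gap_le_one hd h4 hgap
  have hv := one_le_nvar hd h4 hgap
  have hprod : 0 < gap hd D / 150 * lam1 hd D := by positivity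
  have hΔ : 0 < lam - lamHat := by linarith
  have H := solverHyp_of_gap hd h4 hgap hΔ h2
  have A := shiftHyp_of_gap hd h4 hgap hv1 hSv (by linarith) hhi
  have hlam0 : 0 < lam := hΔ.trans_le H.le
  have hS : 0 < nvar D * lam ^ 2 / (lam - lamHat) := by positivity
  have hne : x0 ≠ 0 := by
    rintro rfl
    simp at hx0
  have hunit : ‖(1 / ‖x0‖) • x0‖ = 1 := by
    rw [norm_smul, norm_div, norm_one, norm_norm, one_div_mul_cancel (norm_ne_zero_iff.mpr hne)]
  have hrun : ∀ ω, run lam lamHat (schedule lam lamHat (nvar D) ε δ) x0 ω =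
      loopList (List.range (Nat.clog 4 ⌈(lam - lamHat) / (lam * ε)⌉₊))
        (fun i => powerRound lam lamHat (roundParam hS hΔ (Nat.clog 2 ⌈4096 / δ⌉₊ +
          Nat.clog 4 ⌈(lam - lamHat) / (lam * ε)⌉₊ + i)))
        ((1 / ‖x0‖) • x0) ω ⟨0, 0, 3 * d + 2⟩ := by
    intro ω
    rw [run, onlineSI_eq, bind_apply, schedule, dif_pos ⟨hS, hΔ⟩]
    simp only [loopList_map, tick, zero_add]
  have hcost : ∀ ω, _ := fun ω => loopList_cost
    (List.range (Nat.clog 4 ⌈(lam - lamHat) / (lam * ε)⌉₊))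
    (f := fun i => powerRound lam lamHat (roundParam hS hΔ (Nat.clog 2 ⌈4096 / δ⌉₊ +
          Nat.clog 4 ⌈(lam - lamHat) / (lam * ε)⌉₊ + i)))
    (fun i y ω c => powerRound_cost hd lam lamHat rfl y ω c)
    ((1 / ‖x0‖) • x0) ω ⟨0, 0, 3 * d + 2⟩
  intro result
  refine ⟨fun ω => ?_, measure_aligned_ge H A h1 h2 hl1 (by nlinarith) hx0 hpot hε hδ,
    fun ω => ?_, fun ω => ?_⟩
  · simp only [result, hrun]
    exact loopList_induction (P := fun y : Vec d => ‖y‖ = 1) _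
      (fun i y ω c hy => norm_powerRound hΔ rfl hy ω c) hunit ω _
  · obtain ⟨-, h, -⟩ := hcost ω
    simp only [result, hrun]
    -- If `Δ / (lam ε) ≤ 1`, no round is run and no sample is read. Otherwise rounding up to powers
    -- of `4` loses only a constant factor.
    rcases lt_or_ge 1 ((lam - lamHat) / (lam * ε)) with hr | hr
    · refine le_trans ?_ (samples_bound hl1 hgap hg1 (by linarith) hhi hΔ (by linarith) hv hε
        hδ hδ1 hr)
      have hQ : 1 ≤ nvar D * lam ^ 2 / (lam - lamHat) / (lam - lamHat) := by
        rw [div_div, le_div_iff₀ (by positivity), one_mul]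
        have h3 : (lam - lamHat) * (lam - lamHat) ≤ lam * lam := by
          have := H.le
          gcongr
        nlinarith [sq_nonneg lam]
      refine le_trans ?_ (sum_round_samples_le hS hΔ hQ _ _)
      rw [zero_add] at h
      exact_mod_cast h
    · have h0 : Nat.clog 4 ⌈(lam - lamHat) / (lam * ε)⌉₊ = 0 :=
        Nat.clog_of_right_le_one (Nat.ceil_le.mpr (by simpa using hr)) 4
      have hz : (loopList (List.range (Nat.clog 4 ⌈(lam - lamHat) / (lam * ε)⌉₊))
        (fun i => powerRound lam lamHat (roundParam hS hΔ (Nat.clog 2 ⌈4096 / δ⌉₊ +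
          Nat.clog 4 ⌈(lam - lamHat) / (lam * ε)⌉₊ + i)))
        ((1 / ‖x0‖) • x0) ω ⟨0, 0, 3 * d + 2⟩).2.samples = 0 := by
        rw [h0]; rfl
      rw [hz]
      have hlog : 0 ≤ Real.log (1 / δ) := Real.log_nonneg (by rw [le_div_iff₀ hδ]; linarith)
      have hmax : 0 ≤ max 0 (Real.log (Real.log (1 / ε))) := le_max_left _ _
      push_cast
      positivity
  · obtain ⟨-, -, h⟩ := hcost ω
    simp only [result, hrun]
    simp only [mul_zero, add_zero] at h
    -- The initial normalisation costs `3 d + 2`, which the `+ 1` next to the sample count covers.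
    refine le_trans (Nat.cast_le.mpr h) ?_
    push_cast
    have hd' : (2 : ℝ) ≤ d := by exact_mod_cast hd
    nlinarith [(Nat.cast_nonneg _ : (0 : ℝ) ≤ ((loopList
      (List.range (Nat.clog 4 ⌈(lam - lamHat) / (lam * ε)⌉₊))
        (fun i => powerRound lam lamHat (roundParam hS hΔ (Nat.clog 2 ⌈4096 / δ⌉₊ +
          Nat.clog 4 ⌈(lam - lamHat) / (lam * ε)⌉₊ + i)))
        ((1 / ‖x0‖) • x0) ω ⟨0, 0, 3 * d + 2⟩).2.samples : ℝ))]
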